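/- **Setting.** Let $n\ge 0$ and $\ell\ge 1$ be integers, let $0=\tau_0<\tau_1<\dots<\tau_\ell=\Delta$, and let $|\cdot|$ be the maximum norm on $\mathbb R^n$ and on $\mathbb R^{(\ell+1)n}$. Let $L^\infty=L^\infty([-\Delta,0],\mathbb R^n)$ with the essential supremum norm $\|\cdot\|$, and write $\phi^k\rightharpoonup\phi^0$ for weak-* convergence in $L^\infty$, i.e. $\int_{-\Delta}^0 g^T\phi^k\,ds\to\int_{-\Delta}^0 g^T\phi^0\,ds$ for all $g\in L^1([-\Delta,0],\mathbb R^n)$. For a function $\phi$ on $[-\Delta,0]$ and a function $x$ on an interval starting at $t_0$, let $\phi\diamond_{t_0}x$ be the function equal to $\phi(t-t_0)$ for $t\in[t_0-\Delta,t_0)$ and to $x(t)$ for $t\ge t_0$. For a function $\mathsf x$ put $\mathsf x_t(s)=\mathsf x(t+s)$, $s\in[-\Delta,0]$, and $\mathsf x(t-\tau_{0:\ell})=(\mathsf x(t-\tau_0),\dots,\mathsf x(t-\tau_\ell))$. **Assumptions on** $f:\mathbb R_{\ge0}\times\mathbb R^{(\ell+1)n}\times L^\infty\to\mathbb R^n$: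 1. For all $R>0$, $T>0$ there are $L\ge0$ and a null set $Z$ such that $|f(t,\xi,\phi)-f(t,\zeta,\psi)|\le L\max\{|\xi-\zeta|,\|\phi-\psi\|\}$ whenever $|\xi|,|\zeta|,\|\phi\|,\|\psi\|\le R$ and $t\in[0,T]\setminus Z$. 2. $f(\cdot,0,0)$ is locally essentially bounded. 3. For all $t_0\ge0$, $T>t_0$, all measurable essentially bounded $\phi:[-\Delta,0]\to\mathbb R^n$ and all continuous $x:[t_0,T]\to\mathbb R^n$, the function $t\mapsto f(t,\mathsf x(t-\tau_{0:\ell}),\mathsf x_t)$ with $\mathsf x=\phi\diamond_{t_0}x$ is Lebesgue measurable on $[t_0,T]$. 4. For all $T>0$, $R>0$ there is a null set $Z$ such that for all $\varepsilon>0$ and all sequences $\phi^k\rightharpoonup\phi^0$ with $\|\phi^k\|\le R$ there is $j$ with $|f(t,\xi,\phi^k)-f(t,\xi,\phi^0)|<\varepsilon$ for all $k\ge j$, $t\in[0,T]\setminus Z$ and $|\xi|\le R$. 5. For all $t_0\ge0$, $R\ge0$, all continuous $x:[t_0,t_0+\Delta]\to\mathbb R^n$ with $|x|\le R$, all sequences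 $\phi^k\rightharpoonup\phi^0$ with $\|\phi^k\|\le R$ and all $\varepsilon>0$ there is $j$ such that, with $\mathsf x^k=\phi^k\diamond_{t_0}x$ and $\mathsf x^0=\phi^0\diamond_{t_0}x$, for all $t\in[t_0,t_0+\Delta]$ and $k\ge j$ the following integral exists and satisfies $$\Big|\int_{t_0}^t\big[f(s,\mathsf x^k(s-\tau_{0:\ell}),\mathsf x^0_s)-f(s,\mathsf x^0(s-\tau_{0:\ell}),\mathsf x^0_s)\big]ds\Big|<\varepsilon .$$ **Solutions.** For $t_0\ge0$, $\xi\in\mathbb R^n$, $\phi\in L^\infty$, a solution on an interval $J=[t_0,b)$ or $[t_0,b]$, $t_0<b\le\infty$, is a locally absolutely continuous $x:J\to\mathbb R^n$ with $x(t)=\xi+\int_{t_0}^t f(s,\mathsf x(s-\tau_{0:\ell}),\mathsf x_s)\,ds$ for all $t\in J$, where $\mathsf x=\phi\diamond_{t_0}x$. It is maximal if no solution with the same data strictly extends it. **Theorem.** Let $f$ satisfy 1–5. For all $t_0\ge0$, $\xi\in\mathbb R^n$, $\phi\in L^\infty$ there is a unique maximal solution $x(\cdot;t_0,\xi,\phi)$,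 and its domain has the form $[t_0,T_{(t_0,\xi,\phi)})$ with $t_0<T_{(t_0,\xi,\phi)}\le\infty$. If $T>t_0\ge0$, $R>0$ and $$\inf_{|\xi|\le R,\ \|\phi\|\le R}T_{(t_0,\xi,\phi)}>T,$$ then $$\sup_{t\in[t_0,T],\ |\xi|\le R,\ \|\phi\|\le R}|x(t;t_0,\xi,\phi)|<\infty .$$ -/

import Mathlib

open MeasureTheory Filter Topology Set
open scoped ENNReal

noncomputable section

namespace DelaySystem

/-- Lebesgue measure on the interval `[-Δ, 0]`. -/
abbrev histMeasure (Δ : ℝ) : Measure ℝ := volume.restrict (Icc (-Δ) 0)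

/-- `L^∞([-Δ,0], ℝⁿ)` with the essential supremum norm; `ℝⁿ = Fin n → ℝ` carries the
maximum norm. -/
abbrev LInf (n : ℕ) (Δ : ℝ) : Type := Lp (Fin n → ℝ) ∞ (histMeasure Δ)

/-- The concatenation of a history `φ` (a function on `[-Δ,0]`) and a function `x` on an interval
that starts at `t₀`: it equals `φ (t - t₀)` for `t < t₀` and `x t` for `t₀ ≤ t`. -/
def concat {n : ℕ} (t₀ : ℝ) (φ x : ℝ → Fin n → ℝ) : ℝ → Fin n → ℝ :=
  fun t => if t < t₀ then φ (t - t₀) else x t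

open Classical in
/-- The class in `L^∞([-Δ,0], ℝⁿ)` of the history `s ↦ y (t + s)` of `y` at time `t`.
The value `0` is a default for histories that are not in `L^∞`; by `memLp_history` below it is not
met when `y` is the concatenation of an `L^∞` history and a continuous function. -/
def history {n : ℕ} (Δ : ℝ) (y : ℝ → Fin n → ℝ) (t : ℝ) : LInf n Δ :=
  if h : MemLp (fun s => y (t + s)) ∞ (histMeasure Δ) then h.toLp _ else 0

/-- The vector `(y (t - τ₀), …, y (t - τ_ℓ))` of the delayed values of `y`. -/
def delayed {n ℓ : ℕ} (τ : Fin (ℓ + 1) → ℝ) (y : ℝ → Fin n → ℝ) (t : ℝ) :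
    Fin (ℓ + 1) → Fin n → ℝ :=
  fun i => y (t - τ i)

/-- Right-hand sides `f(t, ξ_{0:ℓ}, φ)`. Only times `t ≥ 0` are ever used. -/
abbrev RHS (n ℓ : ℕ) (Δ : ℝ) : Type :=
  ℝ → (Fin (ℓ + 1) → Fin n → ℝ) → LInf n Δ → Fin n → ℝ

/-- Weak-* convergence of a sequence in `L^∞([-Δ,0], ℝⁿ)`, tested against `L¹([-Δ,0], ℝⁿ)`. -/
def WeakStarTendsto {n : ℕ} {Δ : ℝ} (φ : ℕ → LInf n Δ) (φ₀ : LInf n Δ) : Prop :=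
  ∀ g : ℝ → Fin n → ℝ, Integrable g (histMeasure Δ) →
    Tendsto (fun k => ∫ s, g s ⬝ᵥ φ k s ∂(histMeasure Δ)) atTop
      (𝓝 (∫ s, g s ⬝ᵥ φ₀ s ∂(histMeasure Δ)))

/-- The Lipschitz, boundedness and measurability conditions on a right-hand side. -/
structure LipschitzCaratheodory {n ℓ : ℕ} {Δ : ℝ} (τ : Fin (ℓ + 1) → ℝ) (f : RHS n ℓ Δ) :
    Prop where
  lipschitz : ∀ R > 0, ∀ T > 0, ∃ L ≥ 0, ∃ Z : Set ℝ, volume Z = 0 ∧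
    ∀ t ∈ Icc (0 : ℝ) T \ Z, ∀ ξ ζ : Fin (ℓ + 1) → Fin n → ℝ, ∀ φ ψ : LInf n Δ,
      ‖ξ‖ ≤ R → ‖ζ‖ ≤ R → ‖φ‖ ≤ R → ‖ψ‖ ≤ R →
        ‖f t ξ φ - f t ζ ψ‖ ≤ L * max ‖ξ - ζ‖ ‖φ - ψ‖
  bounded_zero : ∀ T > 0, ∃ C : ℝ, ∀ᵐ t ∂(volume.restrict (Icc 0 T)), ‖f t 0 0‖ ≤ C
  measurable : ∀ t₀ ≥ 0, ∀ T > t₀, ∀ φ x : ℝ → Fin n → ℝ,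
    MemLp φ ∞ (histMeasure Δ) → ContinuousOn x (Icc t₀ T) →
      AEStronglyMeasurable
        (fun t => f t (delayed τ (concat t₀ φ x) t) (history Δ (concat t₀ φ x) t))
        (volume.restrict (Icc t₀ T))

/-- The full assumption on a right-hand side: in addition to the Lipschitz, boundedness and
measurability conditions, weak-* continuity in the distributed-delay argument, uniformly in
`ξ_{0:ℓ}` in balls and in almost every `t` in compact intervals, and the integral condition on the
discrete delays (in which the integral is required to exist). -/
structure WeakStarRegular {n ℓ : ℕ} {Δ : ℝ} (τ : Fin (ℓ + 1) → ℝ) (f : RHS n ℓ Δ) : Prop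
    extends LipschitzCaratheodory τ f where
  weakStar_continuous : ∀ T > 0, ∀ R > 0, ∃ Z : Set ℝ, volume Z = 0 ∧
    ∀ ε > 0, ∀ (φ : ℕ → LInf n Δ) (φ₀ : LInf n Δ), (∀ k, ‖φ k‖ ≤ R) → WeakStarTendsto φ φ₀ →
      ∃ j : ℕ, ∀ k ≥ j, ∀ t ∈ Icc (0 : ℝ) T \ Z, ∀ ξ : Fin (ℓ + 1) → Fin n → ℝ, ‖ξ‖ ≤ R →
        ‖f t ξ (φ k) - f t ξ φ₀‖ < ε
  discrete_integral : ∀ t₀ ≥ 0, ∀ R ≥ 0, ∀ x : ℝ → Fin n → ℝ,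
    ContinuousOn x (Icc t₀ (t₀ + Δ)) → (∀ t ∈ Icc t₀ (t₀ + Δ), ‖x t‖ ≤ R) →
    ∀ (φ : ℕ → LInf n Δ) (φ₀ : LInf n Δ), (∀ k, ‖φ k‖ ≤ R) → WeakStarTendsto φ φ₀ →
    ∀ ε > 0, ∃ j : ℕ, ∀ t ∈ Icc t₀ (t₀ + Δ), ∀ k ≥ j,
      IntervalIntegrable
        (fun s => f s (delayed τ (concat t₀ (φ k) x) s) (history Δ (concat t₀ φ₀ x) s) -
          f s (delayed τ (concat t₀ φ₀ x) s) (history Δ (concat t₀ φ₀ x) s)) volume t₀ t ∧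
      ‖∫ s in t₀..t,
        (f s (delayed τ (concat t₀ (φ k) x) s) (history Δ (concat t₀ φ₀ x) s) -
          f s (delayed τ (concat t₀ φ₀ x) s) (history Δ (concat t₀ φ₀ x) s))‖ < ε

/-- The interval `[t₀, b)`, where `b` may be infinite. -/
def halfOpen (t₀ : ℝ) (b : EReal) : Set ℝ := {t | t₀ ≤ t ∧ (t : EReal) < b}

/-- Intervals of the form `[t₀, b)` or `[t₀, b]` with `t₀ < b ≤ ∞`. -/
def IsForwardInterval (t₀ : ℝ) (J : Set ℝ) : Prop :=
  ∃ b : EReal, (t₀ : EReal) < b ∧ (J = halfOpen t₀ b ∨ J = {t | t₀ ≤ t ∧ (t : EReal) ≤ b})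

/-- `x` is a solution on `J` of `x'(t) = f(t, 𝗑(t - τ_{0:ℓ}), 𝗑_t)` with `𝗑` the concatenation of
`φ` and `x` at `t₀`, and `x(t₀) = ξ`: it is locally absolutely continuous on `J` and satisfies the
integral equation there. Values of `x` outside `J` play no role. -/
structure IsSolution {n ℓ : ℕ} {Δ : ℝ} (τ : Fin (ℓ + 1) → ℝ) (f : RHS n ℓ Δ) (t₀ : ℝ)
    (ξ : Fin n → ℝ) (φ : LInf n Δ) (J : Set ℝ) (x : ℝ → Fin n → ℝ) : Prop where
  interval : IsForwardInterval t₀ J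
  locallyAC : ∀ t ∈ J, AbsolutelyContinuousOnInterval x t₀ t
  integrable : ∀ t ∈ J, IntervalIntegrable
    (fun s => f s (delayed τ (concat t₀ φ x) s) (history Δ (concat t₀ φ x) s)) volume t₀ t
  equation : ∀ t ∈ J,
    x t = ξ + ∫ s in t₀..t, f s (delayed τ (concat t₀ φ x) s) (history Δ (concat t₀ φ x) s)

/-- A solution that has no strict extension to a solution on a larger interval. -/
def IsMaximalSolution {n ℓ : ℕ} {Δ : ℝ} (τ : Fin (ℓ + 1) → ℝ) (f : RHS n ℓ Δ) (t₀ : ℝ)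
    (ξ : Fin n → ℝ) (φ : LInf n Δ) (J : Set ℝ) (x : ℝ → Fin n → ℝ) : Prop :=
  IsSolution τ f t₀ ξ φ J x ∧
    ∀ (J' : Set ℝ) (y : ℝ → Fin n → ℝ), IsSolution τ f t₀ ξ φ J' y → J ⊆ J' → EqOn x y J → J' = J

/-- The histories that occur in the system are in `L^∞`. -/
theorem memLp_history {n : ℕ} {Δ t₀ T : ℝ} {φ x : ℝ → Fin n → ℝ}
    (hφ : MemLp φ ∞ (histMeasure Δ)) (hx : ContinuousOn x (Icc t₀ T)) {t : ℝ}
    (ht : t ∈ Icc t₀ T) :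
    MemLp (fun s => concat t₀ φ x (t + s)) ∞ (histMeasure Δ) := by
  have hshift : MeasurePreserving (fun s : ℝ => s + (t - t₀))
      (volume.restrict ((fun s : ℝ => s + (t - t₀)) ⁻¹' Icc (-Δ) 0)) (histMeasure Δ) :=
    (measurePreserving_add_right volume (t - t₀)).restrict_preimage measurableSet_Icc
  have h₁ : MemLp (fun s => φ (s + (t - t₀))) ∞ ((histMeasure Δ).restrict (Iio (t₀ - t))) := by
    refine (hφ.comp_measurePreserving hshift).mono_measure ?_
    rw [histMeasure, Measure.restrict_restrict measurableSet_Iio]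
    refine Measure.restrict_mono ?_ le_rfl
    rintro s ⟨hs, hs', -⟩
    simp only [mem_Iio] at hs
    simp only [mem_preimage, mem_Icc]
    exact ⟨by linarith [ht.1], by linarith⟩
  have h₂ : MemLp (fun s => x (t + s)) ∞ ((histMeasure Δ).restrict (Iio (t₀ - t))ᶜ) := by
    have hc : ContinuousOn (fun s => x (t + s)) (Icc (t₀ - t) 0) := by
      refine hx.comp (by fun_prop) fun s hs => ?_
      exact ⟨by linarith [hs.1], by linarith [hs.2, ht.2]⟩
    obtain ⟨C, hC⟩ := isCompact_Icc.exists_bound_of_continuousOn hc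
    have h : MemLp (fun s => x (t + s)) ∞ (volume.restrict (Icc (t₀ - t) 0)) :=
      memLp_top_of_bound (hc.aestronglyMeasurable measurableSet_Icc) C
        ((ae_restrict_iff' measurableSet_Icc).2 (Eventually.of_forall hC))
    refine h.mono_measure ?_
    rw [histMeasure, Measure.restrict_restrict measurableSet_Iio.compl]
    refine Measure.restrict_mono ?_ le_rfl
    rintro s ⟨hs, -, hs'⟩
    simp only [mem_compl_iff, mem_Iio, not_lt] at hs
    exact ⟨hs, hs'⟩
  classical
  convert MemLp.piecewise measurableSet_Iio h₁ h₂ using 1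
  funext s
  by_cases hs : t + s < t₀
  · have : s ∈ Iio (t₀ - t) := by simp only [mem_Iio]; linarith
    rw [piecewise_eq_of_mem _ _ _ this]
    simp only [concat, if_pos hs]
    congr 1
    ring
  · have : s ∉ Iio (t₀ - t) := by simp only [mem_Iio]; linarith
    rw [piecewise_eq_of_notMem _ _ _ this]
    simp only [concat, if_neg hs]

end DelaySystem

end

noncomputable section

namespace DelaySystem

/-! Well-posedness. Truncating the solution at level `N` inside the right-hand side makes it
Lipschitz along all continuous functions, so the truncated equation is solvable on any interval by
Picard iteration (`exists_eq_add_integral`). Below level `N` it agrees with the original equation.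
Grönwall then gives uniqueness, and choosing the level above the bound of a given solution on `[t₀,
b]` extends it beyond `b`. Hence a maximal domain is right-open.

Boundedness is a compactness argument. If solutions on `[t₀, T]` were unbounded, data `(ξ k, φ k)`
from the balls would have a subsequence with `ξ k → ξ₀` and `φ k` weak-* convergent to `φ₀`
(`exists_subseq_weakStarTendsto`), and the limit data would still have a solution `x₀` on `[t₀, T]`.
Since `‖φ k - φ₀‖` need not be small, Grönwall cannot compare different histories directly. Instead
`x₀` is frozen: along it the integrated right-hand sides for `φ k` converge, uniformly in time, to
that for `φ₀` (`norm_integral_rhs_sub_lt`). So `x₀` nearly solves the equation for the data `(ξ k, φ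
k)`. Stability with the single history `φ k` (`exists_clamped_stability`) puts the truncated
solution within `1` of `x₀`. It therefore stays below the truncation level and is the true solution,
which bounds the sequence. -/

/-! ### Grönwall and Picard for retarded integral equations -/

/-- With the weight `exp (2L(s - a))`, multiplication by `L` followed by integration gains a factor
`1/2`. Both the Grönwall inequality and the contraction below rest on this gain. -/
theorem norm_integral_le_exp {E : Type*} [NormedAddCommGroup E] [NormedSpace ℝ E] {a b L M : ℝ}
    (hM : 0 ≤ M) {g : ℝ → E}
    (hg : ∀ᵐ s ∂volume.restrict (Icc a b), ‖g s‖ ≤ L * (M * Real.exp (2 * L * (s - a))))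
    {t : ℝ} (ht : t ∈ Icc a b) :
    ‖∫ s in a..t, g s‖ ≤ M / 2 * Real.exp (2 * L * (t - a)) := by
  have hd : ∀ s ∈ uIcc a t, HasDerivAt (fun s => M / 2 * Real.exp (2 * L * (s - a)))
      (L * (M * Real.exp (2 * L * (s - a)))) s := by
    intro s _
    have h1 : HasDerivAt (fun s => 2 * L * (s - a)) (2 * L * 1) s :=
      ((hasDerivAt_id s).sub_const a).const_mul (2 * L)
    refine (h1.exp.const_mul (M / 2)).congr_deriv ?_
    ring
  have hi : IntervalIntegrable (fun s => L * (M * Real.exp (2 * L * (s - a)))) volume a t :=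
    Continuous.intervalIntegrable (by fun_prop) _ _
  have h := intervalIntegral.norm_integral_le_of_norm_le ht.1
    (by
      rw [ae_restrict_iff' measurableSet_Icc] at hg
      filter_upwards [hg] with s hs hs'
      exact hs ⟨hs'.1.le, hs'.2.trans ht.2⟩) hi
  rw [intervalIntegral.integral_eq_sub_of_hasDerivAt hd hi] at h
  simp only [sub_self, mul_zero, Real.exp_zero, mul_one] at h
  linarith

/-- A Grönwall inequality for retarded integral inequalities. -/
theorem le_exp_of_le_add_norm_integral {E : Type*} [NormedAddCommGroup E] [NormedSpace ℝ E]
    {a b L ε : ℝ} (hab : a ≤ b) (hL : 0 < L) (hε : 0 ≤ ε) {d : ℝ → ℝ} {g : ℝ → E}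
    (hd : ContinuousOn d (Icc a b)) (hd₀ : ∀ t ∈ Icc a b, 0 ≤ d t)
    (hg : ∀ᵐ s ∂volume.restrict (Icc a b), ∀ C, (∀ u ∈ Icc a s, d u ≤ C) → ‖g s‖ ≤ L * C)
    (h : ∀ t ∈ Icc a b, d t ≤ ε + ‖∫ s in a..t, g s‖) {t : ℝ} (ht : t ∈ Icc a b) :
    d t ≤ 2 * ε * Real.exp (2 * L * (t - a)) := by
  -- At a maximum point of the weighted function the hypothesis reads `M ≤ ε + M / 2`, hence `M ≤
  -- 2ε`.
  have hc : ContinuousOn (fun t => d t * Real.exp (-(2 * L * (t - a)))) (Icc a b) :=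
    hd.mul (by fun_prop)
  obtain ⟨m, hm, hmax⟩ := isCompact_Icc.exists_isMaxOn (nonempty_Icc.2 hab) hc
  set M := d m * Real.exp (-(2 * L * (m - a))) with hMdef
  have hM : 0 ≤ M := mul_nonneg (hd₀ m hm) (Real.exp_pos _).le
  have hle : ∀ u ∈ Icc a b, d u ≤ M * Real.exp (2 * L * (u - a)) := by
    intro u hu
    have h1 : d u * Real.exp (-(2 * L * (u - a))) ≤ M := hmax hu
    rw [Real.exp_neg] at h1
    rwa [← div_eq_mul_inv, div_le_iff₀ (Real.exp_pos _)] at h1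
  have hg' : ∀ᵐ s ∂volume.restrict (Icc a b),
      ‖g s‖ ≤ L * (M * Real.exp (2 * L * (s - a))) := by
    filter_upwards [hg, ae_restrict_mem measurableSet_Icc] with s hs hs'
    refine hs _ fun u hu => (hle u ⟨hu.1, hu.2.trans hs'.2⟩).trans ?_
    have := hu.2
    gcongr
  have h1 := (h m hm).trans (add_le_add_right (norm_integral_le_exp hM hg' hm) ε)
  have hM2 : M ≤ 2 * ε := by
    have h2 : M ≤ ε * Real.exp (-(2 * L * (m - a))) + M / 2 := by
      calc M ≤ (ε + M / 2 * Real.exp (2 * L * (m - a))) * Real.exp (-(2 * L * (m - a))) := by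
            rw [hMdef]; gcongr
        _ = _ := by
            rw [add_mul, mul_assoc (M / 2), ← Real.exp_add]; simp
    have h3 : Real.exp (-(2 * L * (m - a))) ≤ 1 := by
      rw [Real.exp_le_one_iff]
      have : 0 ≤ m - a := sub_nonneg.2 hm.1
      have := mul_nonneg hL.le this
      linarith
    nlinarith
  refine (hle t ht).trans ?_
  gcongr

/-- Existence for Volterra integral equations with a Lipschitz retarded right-hand side. -/
theorem exists_eq_add_integral {E : Type*} [NormedAddCommGroup E] [NormedSpace ℝ E]
    [CompleteSpace E] {a b L : ℝ} (hab : a ≤ b) (hL : 0 < L) {G : (ℝ → E) → ℝ → E}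
    (hint : ∀ x, ContinuousOn x (Icc a b) → IntervalIntegrable (G x) volume a b)
    (hlip : ∀ x y, ContinuousOn x (Icc a b) → ContinuousOn y (Icc a b) →
      ∀ᵐ s ∂volume.restrict (Icc a b), ∀ C, (∀ u ∈ Icc a s, ‖x u - y u‖ ≤ C) →
        ‖G x s - G y s‖ ≤ L * C) (ξ : E) :
    ∃ x, ContinuousOn x (Icc a b) ∧ ∀ t ∈ Icc a b, x t = ξ + ∫ s in a..t, G x s := by
  let ext : C(Icc a b, E) → ℝ → E := fun x => IccExtend hab x
  have hext : ∀ x : C(Icc a b, E), ContinuousOn (ext x) (Icc a b) := fun x =>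
    (x.continuous.Icc_extend').continuousOn
  have hcont : ∀ x : C(Icc a b, E), ContinuousOn (fun t => ξ + ∫ s in a..t, G (ext x) s)
      (Icc a b) := by
    intro x
    have h := intervalIntegral.continuousOn_primitive_interval'
      (hint _ (hext x)) left_mem_uIcc
    rw [uIcc_of_le hab] at h
    exact continuousOn_const.add h
  let P : C(Icc a b, E) → C(Icc a b, E) := fun x =>
    ⟨(Icc a b).domRestrict (fun t => ξ + ∫ s in a..t, G (ext x) s), (hcont x).domRestrict⟩
  have hP : ∀ (x : C(Icc a b, E)) (t : Icc a b), P x t = ξ + ∫ s in a..t, G (ext x) s :=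
    fun x t => rfl
  have hint' : ∀ x : C(Icc a b, E), ∀ t ∈ Icc a b,
      IntervalIntegrable (G (ext x)) volume a t := fun x t ht =>
    (hint _ (hext x)).mono_set (by
      rw [uIcc_of_le hab, uIcc_of_le ht.1]; exact Icc_subset_Icc_right ht.2)
  have hstep : ∀ (x y : C(Icc a b, E)) (M : ℝ), 0 ≤ M →
      (∀ t : Icc a b, ‖x t - y t‖ ≤ M * Real.exp (2 * L * (t - a))) →
      ∀ t : Icc a b, ‖P x t - P y t‖ ≤ M / 2 * Real.exp (2 * L * (t - a)) := by
    intro x y M hM h t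
    rw [hP, hP, add_sub_add_left_eq_sub,
      ← intervalIntegral.integral_sub (hint' x t t.2) (hint' y t t.2)]
    refine norm_integral_le_exp hM ?_ t.2
    filter_upwards [hlip _ _ (hext x) (hext y), ae_restrict_mem measurableSet_Icc] with s hs hs'
    refine hs _ fun u hu => ?_
    have hu' : u ∈ Icc a b := ⟨hu.1, hu.2.trans hs'.2⟩
    simp only [ext, IccExtend_of_mem hab _ hu']
    refine (h ⟨u, hu'⟩).trans ?_
    have := hu.2
    gcongr
  have hiter : ∀ (x y : C(Icc a b, E)) (k : ℕ) (t : Icc a b),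
      ‖P^[k] x t - P^[k] y t‖ ≤ dist x y / 2 ^ k * Real.exp (2 * L * (t - a)) := by
    intro x y k
    induction k with
    | zero =>
      intro t
      simp only [Function.iterate_zero, id, pow_zero, div_one]
      rw [← dist_eq_norm]
      refine (ContinuousMap.dist_apply_le_dist t).trans (le_mul_of_one_le_right dist_nonneg ?_)
      rw [Real.one_le_exp_iff]
      exact mul_nonneg (by positivity) (sub_nonneg.2 t.2.1)
    | succ k ih =>
      intro t
      rw [Function.iterate_succ_apply', Function.iterate_succ_apply']
      refine (hstep _ _ _ (by positivity) ih t).trans (le_of_eq ?_)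
      rw [pow_succ]; ring
  -- Each application of `P` halves the weighted distance. With this `k` the gain outweighs the
  -- weight, so `P^[k]` contracts in the sup norm by `1/2`; its fixed point is also one of `P`.
  obtain ⟨k, hk⟩ := pow_unbounded_of_one_lt (2 * Real.exp (2 * L * (b - a)))
    (one_lt_two : (1 : ℝ) < 2)
  have hcontr : ContractingWith (1 / 2) P^[k] := by
    refine ⟨by rw [← NNReal.coe_lt_coe]; norm_num, LipschitzWith.of_dist_le_mul fun x y => ?_⟩
    rw [ContinuousMap.dist_le (by positivity)]
    intro t
    rw [dist_eq_norm]
    refine (hiter x y k t).trans ?_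
    have h1 : Real.exp (2 * L * (t - a)) ≤ 2 ^ k / 2 := by
      refine le_trans ?_ ((le_div_iff₀' two_pos).2 hk.le)
      have := t.2.2
      gcongr
    calc dist x y / 2 ^ k * Real.exp (2 * L * (t - a)) ≤ dist x y / 2 ^ k * (2 ^ k / 2) := by
          gcongr
      _ = _ := by
          push_cast
          field_simp
  have : Nonempty C(Icc a b, E) := ⟨0⟩
  have hfix := hcontr.isFixedPt_fixedPoint_iterate
  set z := ContractingWith.fixedPoint P^[k] hcontr
  refine ⟨ext z, hext z, fun t ht => ?_⟩
  have h1 := congrArg (fun x : C(Icc a b, E) => x ⟨t, ht⟩) hfix.eq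
  simp only [hP] at h1
  rw [h1]
  simp only [ext, IccExtend_of_mem hab _ ht]

/-! ### The right-hand side along concatenated functions -/

section

variable {n ℓ : ℕ} {Δ : ℝ} {τ : Fin (ℓ + 1) → ℝ} {f : RHS n ℓ Δ} {t₀ T : ℝ}

theorem LInf.ae_norm_le (φ : LInf n Δ) : ∀ᵐ s ∂histMeasure Δ, ‖φ s‖ ≤ ‖φ‖ := by
  filter_upwards [ae_le_lpNorm_exponent_top (Lp.memLp φ)] with s hs
  rwa [Lp.norm_def, toReal_eLpNorm (Lp.aestronglyMeasurable φ)]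

theorem LInf.norm_le_of_ae {φ : LInf n Δ} {C : ℝ} (hC : 0 ≤ C)
    (h : ∀ᵐ s ∂histMeasure Δ, ‖φ s‖ ≤ C) : ‖φ‖ ≤ C := by
  simpa using Lp.norm_le_of_ae_bound hC h

theorem concat_of_lt {φ x : ℝ → Fin n → ℝ} {t : ℝ} (h : t < t₀) :
    concat t₀ φ x t = φ (t - t₀) := if_pos h

theorem concat_of_le {φ x : ℝ → Fin n → ℝ} {t : ℝ} (h : t₀ ≤ t) :
    concat t₀ φ x t = x t := if_neg (not_lt.2 h)

theorem ae_norm_shift_le (φ : LInf n Δ) (c : ℝ) :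
    ∀ᵐ s, s - c ∈ Icc (-Δ) 0 → ‖φ (s - c)‖ ≤ ‖φ‖ := by
  have h := (ae_restrict_iff' measurableSet_Icc).1 (LInf.ae_norm_le φ)
  exact (measurePreserving_sub_right volume c).quasiMeasurePreserving.ae h

/-- The delayed values read a representative of `φ` pointwise, so they respect the essential bound
only off the null sets obtained by translating the exceptional set of `φ`. -/
theorem ae_norm_delayed_le (hτ : ∀ i, τ i ∈ Icc 0 Δ) {φ : LInf n Δ} {x : ℝ → Fin n → ℝ} {R : ℝ}
    (hφ : ‖φ‖ ≤ R) (hxR : ∀ t ∈ Icc t₀ T, ‖x t‖ ≤ R) :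
    ∀ᵐ s ∂volume.restrict (Icc t₀ T), ‖delayed τ (concat t₀ φ x) s‖ ≤ R := by
  have h : ∀ᵐ s ∂volume.restrict (Icc t₀ T), ∀ i,
      s - (τ i + t₀) ∈ Icc (-Δ) 0 → ‖φ (s - (τ i + t₀))‖ ≤ ‖φ‖ :=
    ae_all_iff.2 fun i => ae_restrict_of_ae (ae_norm_shift_le φ (τ i + t₀))
  filter_upwards [h, ae_restrict_mem measurableSet_Icc] with s hs hs'
  refine (pi_norm_le_iff_of_nonneg ((norm_nonneg _).trans hφ)).2 fun i => ?_
  rw [delayed]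
  have hi := hτ i
  rcases lt_or_ge (s - τ i) t₀ with hlt | hge
  · rw [concat_of_lt hlt, sub_sub]
    exact (hs i ⟨by linarith [hi.2, hs'.1], by linarith⟩).trans hφ
  · rw [concat_of_le hge]
    exact hxR _ ⟨hge, by linarith [hi.1, hs'.2]⟩

theorem history_ae_eq {φ x : ℝ → Fin n → ℝ} (hφ : MemLp φ ∞ (histMeasure Δ))
    (hx : ContinuousOn x (Icc t₀ T)) {t : ℝ} (ht : t ∈ Icc t₀ T) :
    history Δ (concat t₀ φ x) t =ᵐ[histMeasure Δ] fun s => concat t₀ φ x (t + s) := by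
  rw [history, dif_pos (memLp_history hφ hx ht)]
  exact MemLp.coeFn_toLp _

theorem history_congr {y z : ℝ → Fin n → ℝ} {t : ℝ}
    (h : ∀ s ∈ Icc (-Δ) 0, y (t + s) = z (t + s)) : history Δ y t = history Δ z t := by
  have hae : (fun s => y (t + s)) =ᵐ[histMeasure Δ] fun s => z (t + s) :=
    (ae_restrict_iff' measurableSet_Icc).2 (Eventually.of_forall h)
  by_cases hy : MemLp (fun s => y (t + s)) ∞ (histMeasure Δ)
  · have hz := (memLp_congr_ae hae).1 hy
    rw [history, history, dif_pos hy, dif_pos hz]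
    exact MemLp.toLp_congr _ _ hae
  · have hz := fun hz => hy ((memLp_congr_ae hae).2 hz)
    rw [history, history, dif_neg hy, dif_neg hz]

theorem norm_history_le {φ : LInf n Δ} {x : ℝ → Fin n → ℝ} {R : ℝ} (hφ : ‖φ‖ ≤ R)
    (hx : ContinuousOn x (Icc t₀ T)) (hxR : ∀ t ∈ Icc t₀ T, ‖x t‖ ≤ R) {t : ℝ}
    (ht : t ∈ Icc t₀ T) : ‖history Δ (concat t₀ φ x) t‖ ≤ R := by
  refine LInf.norm_le_of_ae ((norm_nonneg _).trans hφ) ?_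
  have h := ae_restrict_of_ae (s := Icc (-Δ) 0) (ae_norm_shift_le φ (t₀ - t))
  filter_upwards [history_ae_eq (Lp.memLp φ) hx ht, h, ae_restrict_mem measurableSet_Icc]
    with s hs hs' hs''
  rw [hs]
  rcases lt_or_ge (t + s) t₀ with hlt | hge
  · rw [concat_of_lt hlt, show t + s - t₀ = s - (t₀ - t) by ring]
    exact (hs' ⟨by linarith [ht.1, hs''.1], by linarith⟩).trans hφ
  · rw [concat_of_le hge]
    exact hxR _ ⟨hge, by linarith [ht.2, hs''.2]⟩

theorem norm_concat_sub_le {φ x y : ℝ → Fin n → ℝ} {s t C : ℝ} (hC : 0 ≤ C)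
    (h : ∀ u ∈ Icc t₀ s, ‖x u - y u‖ ≤ C) (hts : t ≤ s) :
    ‖concat t₀ φ x t - concat t₀ φ y t‖ ≤ C := by
  rcases lt_or_ge t t₀ with hlt | hge
  · rw [concat_of_lt hlt, concat_of_lt hlt, sub_self, norm_zero]
    exact hC
  · rw [concat_of_le hge, concat_of_le hge]
    exact h t ⟨hge, hts⟩

theorem norm_history_sub_le {φ : LInf n Δ} {x y : ℝ → Fin n → ℝ}
    (hx : ContinuousOn x (Icc t₀ T)) (hy : ContinuousOn y (Icc t₀ T)) {t C : ℝ}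
    (ht : t ∈ Icc t₀ T) (hC : 0 ≤ C) (h : ∀ u ∈ Icc t₀ t, ‖x u - y u‖ ≤ C) :
    ‖history Δ (concat t₀ φ x) t - history Δ (concat t₀ φ y) t‖ ≤ C := by
  refine LInf.norm_le_of_ae hC ?_
  filter_upwards [history_ae_eq (Lp.memLp φ) hx ht, history_ae_eq (Lp.memLp φ) hy ht,
    Lp.coeFn_sub (history Δ (concat t₀ φ x) t) (history Δ (concat t₀ φ y) t),
    ae_restrict_mem measurableSet_Icc] with s hs hs' hs'' hmem
  rw [hs'', Pi.sub_apply, hs, hs']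
  exact norm_concat_sub_le hC h (by linarith [hmem.2])

/-- The right-hand side along the concatenation of `φ` and `x` at `t₀`. -/
def rhs (τ : Fin (ℓ + 1) → ℝ) (f : RHS n ℓ Δ) (t₀ : ℝ) (φ x : ℝ → Fin n → ℝ) (s : ℝ) :
    Fin n → ℝ :=
  f s (delayed τ (concat t₀ φ x) s) (history Δ (concat t₀ φ x) s)

/-- Causality: the delays are nonnegative, so only values up to time `s` enter. -/
theorem rhs_congr (hτ : ∀ i, τ i ∈ Icc 0 Δ) {φ x y : ℝ → Fin n → ℝ} {s : ℝ}
    (h : EqOn x y (Icc t₀ s)) : rhs τ f t₀ φ x s = rhs τ f t₀ φ y s := by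
  have hc : ∀ t ≤ s, concat t₀ φ x t = concat t₀ φ y t := by
    intro t hts
    rcases lt_or_ge t t₀ with hlt | hge
    · rw [concat_of_lt hlt, concat_of_lt hlt]
    · rw [concat_of_le hge, concat_of_le hge]
      exact h ⟨hge, hts⟩
  have h1 : delayed τ (concat t₀ φ x) s = delayed τ (concat t₀ φ y) s := by
    funext i
    exact hc _ (by linarith [(hτ i).1])
  have h2 : history Δ (concat t₀ φ x) s = history Δ (concat t₀ φ y) s :=
    history_congr fun r hr => hc _ (by linarith [hr.2])
  rw [rhs, rhs, h1, h2]

theorem integral_rhs_congr (hτ : ∀ i, τ i ∈ Icc 0 Δ) {φ x y : ℝ → Fin n → ℝ} {t : ℝ}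
    (ht : t₀ ≤ t) (h : EqOn x y (Icc t₀ t)) :
    ∫ s in t₀..t, rhs τ f t₀ φ x s = ∫ s in t₀..t, rhs τ f t₀ φ y s := by
  refine intervalIntegral.integral_congr fun s hs => ?_
  rw [uIcc_of_le ht] at hs
  exact rhs_congr hτ (h.mono (Icc_subset_Icc_right hs.2))

/-- Both functions share the history `φ`, so their concatenations differ only after `t₀`. The
constant depends neither on `t₀` nor on `φ`, and `C` is quantified inside the null set, as the
Grönwall lemma requires. -/
theorem LipschitzCaratheodory.exists_rhs_lipschitz (hf : LipschitzCaratheodory τ f)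
    (hτ : ∀ i, τ i ∈ Icc 0 Δ) {R : ℝ} (hR : 0 < R) (hT : 0 < T) :
    ∃ L > 0, ∀ t₀ ≥ 0, ∀ φ : LInf n Δ, ‖φ‖ ≤ R → ∀ x y : ℝ → Fin n → ℝ,
      ContinuousOn x (Icc t₀ T) → ContinuousOn y (Icc t₀ T) →
      (∀ t ∈ Icc t₀ T, ‖x t‖ ≤ R) → (∀ t ∈ Icc t₀ T, ‖y t‖ ≤ R) →
      ∀ᵐ s ∂volume.restrict (Icc t₀ T), ∀ C, (∀ u ∈ Icc t₀ s, ‖x u - y u‖ ≤ C) →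
        ‖rhs τ f t₀ φ x s - rhs τ f t₀ φ y s‖ ≤ L * C := by
  obtain ⟨L, hL, Z, hZ, h⟩ := hf.lipschitz R hR T hT
  -- `L + 1` instead of `L` ensures a strictly positive constant.
  refine ⟨L + 1, by positivity, fun t₀ ht₀ φ hφ x y hx hy hxR hyR => ?_⟩
  have hZ' : ∀ᵐ s ∂volume.restrict (Icc t₀ T), s ∉ Z :=
    ae_restrict_of_ae (measure_eq_zero_iff_ae_notMem.1 hZ)
  filter_upwards [hZ', ae_norm_delayed_le hτ hφ hxR, ae_norm_delayed_le hτ hφ hyR,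
    ae_restrict_mem measurableSet_Icc] with s hs hxs hys hmem C hC
  have hC₀ : 0 ≤ C := (norm_nonneg _).trans (hC s ⟨hmem.1, le_rfl⟩)
  have h1 := h s ⟨⟨ht₀.le.trans hmem.1, hmem.2⟩, hs⟩ _ _ _ _ hxs hys
    (norm_history_le hφ hx hxR hmem) (norm_history_le hφ hy hyR hmem)
  refine h1.trans ?_
  have h2 : max ‖delayed τ (concat t₀ φ x) s - delayed τ (concat t₀ φ y) s‖
      ‖history Δ (concat t₀ φ x) s - history Δ (concat t₀ φ y) s‖ ≤ C := by
    refine max_le ((pi_norm_le_iff_of_nonneg hC₀).2 fun i => ?_)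
      (norm_history_sub_le hx hy hmem hC₀ hC)
    exact norm_concat_sub_le hC₀ hC (by linarith [(hτ i).1])
  calc L * _ ≤ L * C := by gcongr
    _ ≤ (L + 1) * C := by gcongr; linarith

theorem LipschitzCaratheodory.exists_rhs_bound (hf : LipschitzCaratheodory τ f)
    (hτ : ∀ i, τ i ∈ Icc 0 Δ) {R : ℝ} (hR : 0 < R) (hT : 0 < T) :
    ∃ B ≥ 0, ∀ t₀ ≥ 0, ∀ φ : LInf n Δ, ‖φ‖ ≤ R → ∀ x : ℝ → Fin n → ℝ,
      ContinuousOn x (Icc t₀ T) → (∀ t ∈ Icc t₀ T, ‖x t‖ ≤ R) →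
      ∀ᵐ s ∂volume.restrict (Icc t₀ T), ‖rhs τ f t₀ φ x s‖ ≤ B := by
  obtain ⟨L, hL, Z, hZ, h⟩ := hf.lipschitz R hR T hT
  obtain ⟨C, hC⟩ := hf.bounded_zero T hT
  refine ⟨L * R + max C 0, by positivity, fun t₀ ht₀ φ hφ x hx hxR => ?_⟩
  have hZ' : ∀ᵐ s ∂volume.restrict (Icc t₀ T), s ∉ Z :=
    ae_restrict_of_ae (measure_eq_zero_iff_ae_notMem.1 hZ)
  have hC' := ae_restrict_of_ae_restrict_of_subset (Icc_subset_Icc_left (b := T) ht₀.le) hC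
  filter_upwards [hZ', hC', ae_norm_delayed_le hτ hφ hxR, ae_restrict_mem measurableSet_Icc]
    with s hs hCs hxs hmem
  have hh := norm_history_le hφ hx hxR hmem
  have h1 := h s ⟨⟨ht₀.le.trans hmem.1, hmem.2⟩, hs⟩ (delayed τ (concat t₀ φ x) s) 0
    (history Δ (concat t₀ φ x) s) 0 hxs (by simpa using hR.le) hh (by simpa using hR.le)
  rw [sub_zero, sub_zero] at h1
  have h2 : L * max ‖delayed τ (concat t₀ φ x) s‖ ‖history Δ (concat t₀ φ x) s‖ ≤ L * R := by
    have := max_le hxs hh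
    gcongr
  calc ‖rhs τ f t₀ φ x s‖ ≤ ‖rhs τ f t₀ φ x s - f s 0 0‖ + ‖f s 0 0‖ := norm_le_norm_sub_add _ _
    _ ≤ L * R + max C 0 := add_le_add (h1.trans h2) (hCs.trans (le_max_left _ _))

theorem exists_common_bound (φ : LInf n Δ) {x : ℝ → Fin n → ℝ} (hx : ContinuousOn x (Icc t₀ T)) :
    ∃ R > 0, ‖φ‖ ≤ R ∧ ∀ t ∈ Icc t₀ T, ‖x t‖ ≤ R := by
  obtain ⟨C, hC⟩ := isCompact_Icc.exists_bound_of_continuousOn hx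
  refine ⟨max C ‖φ‖ + 1, ?_, ?_, fun t ht => ?_⟩
  · linarith [le_max_right C ‖φ‖, norm_nonneg φ]
  · linarith [le_max_right C ‖φ‖]
  · linarith [le_max_left C ‖φ‖, hC t ht]

theorem LipschitzCaratheodory.exists_ae_norm_rhs_le (hf : LipschitzCaratheodory τ f)
    (hτ : ∀ i, τ i ∈ Icc 0 Δ) (ht₀ : 0 ≤ t₀) (φ : LInf n Δ)
    {x : ℝ → Fin n → ℝ} (hx : ContinuousOn x (Icc t₀ T)) :
    ∃ B ≥ 0, ∀ᵐ s ∂volume.restrict (Icc t₀ T), ‖rhs τ f t₀ φ x s‖ ≤ B := by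
  rcases le_or_gt T t₀ with hT | hT
  · refine ⟨0, le_rfl, ?_⟩
    have : volume (Icc t₀ T) = 0 := by simp [hT]
    simp [Measure.restrict_eq_zero.2 this]
  obtain ⟨R, hR, hφ, hxR⟩ := exists_common_bound φ hx
  obtain ⟨B, hB, h⟩ := hf.exists_rhs_bound hτ hR (ht₀.trans_lt hT)
  exact ⟨B, hB, h t₀ ht₀ φ hφ x hx hxR⟩

theorem LipschitzCaratheodory.intervalIntegrable_rhs (hf : LipschitzCaratheodory τ f)
    (hτ : ∀ i, τ i ∈ Icc 0 Δ) (ht₀ : 0 ≤ t₀) (htT : t₀ ≤ T) (φ : LInf n Δ)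
    {x : ℝ → Fin n → ℝ} (hx : ContinuousOn x (Icc t₀ T)) :
    IntervalIntegrable (rhs τ f t₀ φ x) volume t₀ T := by
  rcases htT.eq_or_lt with rfl | hT
  · exact IntervalIntegrable.refl
  obtain ⟨B, -, hB⟩ := hf.exists_ae_norm_rhs_le hτ ht₀ φ hx
  rw [intervalIntegrable_iff_integrableOn_Icc_of_le htT]
  exact Integrable.of_bound (hf.measurable t₀ ht₀ T hT φ x (Lp.memLp φ) hx) B hB

end

/-! ### The truncated equation and well-posedness -/

section

variable {n ℓ : ℕ} {Δ : ℝ} {τ : Fin (ℓ + 1) → ℝ} {f : RHS n ℓ Δ} {t₀ T : ℝ}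

/-- The componentwise truncation of a vector to the cube `[-N, N]ⁿ`. -/
def clamp (N : ℝ) (v : Fin n → ℝ) : Fin n → ℝ := fun i => max (-N) (min N (v i))

theorem norm_clamp_le {N : ℝ} (hN : 0 ≤ N) (v : Fin n → ℝ) : ‖clamp N v‖ ≤ N := by
  refine (pi_norm_le_iff_of_nonneg hN).2 fun i => ?_
  rw [Real.norm_eq_abs, abs_le]
  exact ⟨le_max_left _ _, max_le (by linarith) (min_le_left _ _)⟩

theorem clamp_eq_self {N : ℝ} {v : Fin n → ℝ} (h : ‖v‖ ≤ N) : clamp N v = v := by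
  funext i
  have hi := abs_le.1 ((Real.norm_eq_abs _ ▸ norm_le_pi_norm v i).trans h)
  rw [clamp, min_eq_right hi.2, max_eq_right hi.1]

theorem norm_clamp_sub_clamp_le (N : ℝ) (v w : Fin n → ℝ) :
    ‖clamp N v - clamp N w‖ ≤ ‖v - w‖ := by
  refine (pi_norm_le_iff_of_nonneg (norm_nonneg _)).2 fun i => ?_
  refine le_trans ?_ (norm_le_pi_norm (v - w) i)
  simp only [Pi.sub_apply, clamp, Real.norm_eq_abs]
  rw [max_comm (-N), max_comm (-N)]
  refine (abs_sup_sub_sup_le_abs _ _ _).trans ?_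
  rw [min_comm N, min_comm N]
  exact abs_inf_sub_inf_le_abs _ _ _

theorem continuous_clamp (N : ℝ) : Continuous (clamp N : (Fin n → ℝ) → Fin n → ℝ) := by
  unfold clamp
  fun_prop

/-- `x` is continuous and satisfies the integral equation on `[t₀, b]`. -/
structure IsSolOn (τ : Fin (ℓ + 1) → ℝ) (f : RHS n ℓ Δ) (t₀ : ℝ) (ξ : Fin n → ℝ) (φ : LInf n Δ)
    (b : ℝ) (x : ℝ → Fin n → ℝ) : Prop where
  continuousOn : ContinuousOn x (Icc t₀ b)
  equation : ∀ t ∈ Icc t₀ b, x t = ξ + ∫ s in t₀..t, rhs τ f t₀ φ x s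

/-- `x` is continuous and satisfies on `[t₀, b]` the integral equation in which the solution is
truncated at the level `N` on the right-hand side. -/
structure IsClampedSolOn (τ : Fin (ℓ + 1) → ℝ) (f : RHS n ℓ Δ) (t₀ : ℝ) (ξ : Fin n → ℝ)
    (φ : LInf n Δ) (N b : ℝ) (x : ℝ → Fin n → ℝ) : Prop where
  continuousOn : ContinuousOn x (Icc t₀ b)
  equation : ∀ t ∈ Icc t₀ b, x t = ξ + ∫ s in t₀..t, rhs τ f t₀ φ (fun u => clamp N (x u)) s

variable {ξ : Fin n → ℝ} {φ : LInf n Δ} {x y z : ℝ → Fin n → ℝ} {b c N : ℝ}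

theorem IsSolOn.mono (h : IsSolOn τ f t₀ ξ φ b x) (hcb : c ≤ b) : IsSolOn τ f t₀ ξ φ c x :=
  ⟨h.continuousOn.mono (Icc_subset_Icc_right hcb), fun t ht =>
    h.equation t ⟨ht.1, ht.2.trans hcb⟩⟩

theorem IsClampedSolOn.mono (h : IsClampedSolOn τ f t₀ ξ φ N b x) (hcb : c ≤ b) :
    IsClampedSolOn τ f t₀ ξ φ N c x :=
  ⟨h.continuousOn.mono (Icc_subset_Icc_right hcb), fun t ht =>
    h.equation t ⟨ht.1, ht.2.trans hcb⟩⟩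

theorem IsSolOn.congr (hτ : ∀ i, τ i ∈ Icc 0 Δ) (h : IsSolOn τ f t₀ ξ φ b x)
    (hxy : EqOn x y (Icc t₀ b)) : IsSolOn τ f t₀ ξ φ b y := by
  refine ⟨h.continuousOn.congr hxy.symm, fun t ht => ?_⟩
  rw [← hxy ht, h.equation t ht,
    integral_rhs_congr hτ ht.1 (hxy.mono (Icc_subset_Icc_right ht.2))]

theorem isClampedSolOn_iff (hτ : ∀ i, τ i ∈ Icc 0 Δ) (hN : ∀ t ∈ Icc t₀ b, ‖x t‖ ≤ N) :
    IsClampedSolOn τ f t₀ ξ φ N b x ↔ IsSolOn τ f t₀ ξ φ b x := by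
  have h : EqOn (fun u => clamp N (x u)) x (Icc t₀ b) := fun u hu => clamp_eq_self (hN u hu)
  have hi : ∀ t ∈ Icc t₀ b, ∫ s in t₀..t, rhs τ f t₀ φ (fun u => clamp N (x u)) s =
      ∫ s in t₀..t, rhs τ f t₀ φ x s := fun t ht =>
    integral_rhs_congr hτ ht.1 (h.mono (Icc_subset_Icc_right ht.2))
  constructor
  · exact fun hx => ⟨hx.continuousOn, fun t ht => (hx.equation t ht).trans (by rw [hi t ht])⟩
  · exact fun hx => ⟨hx.continuousOn, fun t ht => (hx.equation t ht).trans (by rw [hi t ht])⟩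

theorem LipschitzCaratheodory.exists_isClampedSolOn (hf : LipschitzCaratheodory τ f)
    (hτ : ∀ i, τ i ∈ Icc 0 Δ) (ht₀ : 0 ≤ t₀) (hT : t₀ < T) (hN : 0 < N) (ξ : Fin n → ℝ)
    (hφ : ‖φ‖ ≤ N) : ∃ x, IsClampedSolOn τ f t₀ ξ φ N T x := by
  obtain ⟨L, hL, h⟩ := hf.exists_rhs_lipschitz hτ hN (ht₀.trans_lt hT)
  have hc : ∀ x : ℝ → Fin n → ℝ, ContinuousOn x (Icc t₀ T) →
      ContinuousOn (fun u => clamp N (x u)) (Icc t₀ T) := fun x hx =>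
    (continuous_clamp N).comp_continuousOn hx
  obtain ⟨x, hx, heq⟩ := exists_eq_add_integral hT.le hL
    (G := fun x => rhs τ f t₀ φ (fun u => clamp N (x u)))
    (fun x hx => hf.intervalIntegrable_rhs hτ ht₀ hT.le φ (hc x hx))
    (fun x y hx hy => by
      filter_upwards [h t₀ ht₀ φ hφ _ _ (hc x hx) (hc y hy)
        (fun t _ => norm_clamp_le hN.le _) (fun t _ => norm_clamp_le hN.le _)] with s hs C hC
      exact hs C fun u hu => (norm_clamp_sub_clamp_le N _ _).trans (hC u hu)) ξ
  exact ⟨x, hx, heq⟩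

/-- Approximate solutions bounded by `N` are close to the truncated solution. -/
theorem LipschitzCaratheodory.exists_clamped_stability (hf : LipschitzCaratheodory τ f)
    (hτ : ∀ i, τ i ∈ Icc 0 Δ) (hN : 0 < N) (hT : 0 < T) :
    ∃ L, ∀ t₀ ≥ 0, ∀ (ξ : Fin n → ℝ) (φ : LInf n Δ), ‖φ‖ ≤ N → ∀ z x : ℝ → Fin n → ℝ,
      IsClampedSolOn τ f t₀ ξ φ N T z → ContinuousOn x (Icc t₀ T) →
      (∀ t ∈ Icc t₀ T, ‖x t‖ ≤ N) → ∀ ε ≥ 0,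
      (∀ t ∈ Icc t₀ T, ‖ξ + (∫ s in t₀..t, rhs τ f t₀ φ x s) - x t‖ ≤ ε) →
      ∀ t ∈ Icc t₀ T, ‖z t - x t‖ ≤ 2 * ε * Real.exp (2 * L * (t - t₀)) := by
  obtain ⟨L, hL, h⟩ := hf.exists_rhs_lipschitz hτ hN hT
  refine ⟨L, fun t₀ ht₀ ξ φ hφ z x hz hx hxN ε hε happ t ht => ?_⟩
  have hc : ContinuousOn (fun u => clamp N (z u)) (Icc t₀ T) :=
    (continuous_clamp N).comp_continuousOn hz.continuousOn
  refine le_exp_of_le_add_norm_integral (d := fun t => ‖z t - x t‖)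
    (g := fun s => rhs τ f t₀ φ (fun u => clamp N (z u)) s - rhs τ f t₀ φ x s)
    (ht.1.trans ht.2) hL hε (hz.continuousOn.sub hx).norm (fun _ _ => norm_nonneg _) ?_ ?_ ht
  · filter_upwards [h t₀ ht₀ φ hφ _ _ hc hx (fun t _ => norm_clamp_le hN.le _) hxN,
      ae_restrict_mem measurableSet_Icc] with s hs hmem C hC
    refine hs C fun u hu => le_trans ?_ (hC u hu)
    -- As `‖x‖ ≤ N`, `x` equals its own truncation, and truncation does not increase distances.
    have hxu := clamp_eq_self (hxN u ⟨hu.1, hu.2.trans hmem.2⟩)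
    calc ‖clamp N (z u) - x u‖ = ‖clamp N (z u) - clamp N (x u)‖ := by rw [hxu]
      _ ≤ _ := norm_clamp_sub_clamp_le N _ _
  · intro t ht
    have hsub : Icc t₀ t ⊆ Icc t₀ T := Icc_subset_Icc_right ht.2
    rw [intervalIntegral.integral_sub (hf.intervalIntegrable_rhs hτ ht₀ ht.1 φ (hc.mono hsub))
      (hf.intervalIntegrable_rhs hτ ht₀ ht.1 φ (hx.mono hsub)), hz.equation t ht]
    refine le_trans ?_ (add_le_add_left (happ t ht) _)
    refine le_trans (le_of_eq ?_) (norm_add_le _ _)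
    congr 1
    abel

/-- This is the stability estimate with defect `ε = 0`. -/
theorem IsSolOn.eqOn_clamped (hf : LipschitzCaratheodory τ f) (hτ : ∀ i, τ i ∈ Icc 0 Δ)
    (ht₀ : 0 ≤ t₀) (hx : IsSolOn τ f t₀ ξ φ b x) (hxN : ∀ t ∈ Icc t₀ b, ‖x t‖ ≤ N) (hφ : ‖φ‖ ≤ N)
    (hN : 0 < N) (hz : IsClampedSolOn τ f t₀ ξ φ N b z) : EqOn z x (Icc t₀ b) := by
  intro t ht
  rcases (ht₀.trans (ht.1.trans ht.2)).eq_or_lt with hb | hb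
  · have : t = t₀ := le_antisymm (by linarith [ht.2]) ht.1
    rw [hz.equation t ht, hx.equation t ht, this]
    simp
  obtain ⟨L, hL⟩ := hf.exists_clamped_stability hτ hN hb
  have h := hL t₀ ht₀ ξ φ hφ z x hz hx.continuousOn hxN 0 le_rfl
    (fun t ht => by rw [← hx.equation t ht]; simp) t ht
  simp only [mul_zero, zero_mul, norm_le_zero_iff] at h
  exact sub_eq_zero.1 h

/-- At a level above the bounds of `x` and `y`, the first also solves the truncated equation, whose
solution must agree with the second. -/
theorem IsSolOn.eqOn (hf : LipschitzCaratheodory τ f) (hτ : ∀ i, τ i ∈ Icc 0 Δ) (ht₀ : 0 ≤ t₀)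
    (hx : IsSolOn τ f t₀ ξ φ b x) (hy : IsSolOn τ f t₀ ξ φ b y) : EqOn x y (Icc t₀ b) := by
  obtain ⟨N₁, hN₁, -, hxN⟩ := exists_common_bound φ hx.continuousOn
  obtain ⟨N₂, -, hφ, hyN⟩ := exists_common_bound φ hy.continuousOn
  refine hy.eqOn_clamped hf hτ ht₀ (N := max N₁ N₂)
    (fun t ht => (hyN t ht).trans (le_max_right _ _))
    (hφ.trans (le_max_right _ _)) (hN₁.trans_le (le_max_left _ _)) ?_
  exact (isClampedSolOn_iff hτ fun t ht => (hxN t ht).trans (le_max_left _ _)).2 hx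

theorem IsSolOn.exists_extension (hf : LipschitzCaratheodory τ f) (hτ : ∀ i, τ i ∈ Icc 0 Δ)
    (ht₀ : 0 ≤ t₀) (htb : t₀ ≤ b) (hx : IsSolOn τ f t₀ ξ φ b x) :
    ∃ c > b, ∃ z, IsSolOn τ f t₀ ξ φ c z := by
  obtain ⟨N, hN, hφ, hxN⟩ := exists_common_bound φ hx.continuousOn
  -- The level `N + 1` lies strictly above the bound of `x`, so by continuity the truncation stays
  -- inactive for a short time after `b`.
  obtain ⟨z, hz⟩ := hf.exists_isClampedSolOn hτ ht₀ (T := b + 1) (by linarith)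
    (N := N + 1) (by linarith) ξ (φ := φ) (by linarith)
  have heq : EqOn z x (Icc t₀ b) := hx.eqOn_clamped hf hτ ht₀
    (fun t ht => by linarith [hxN t ht]) (by linarith) (by linarith) (hz.mono (by linarith))
  have hzb : ‖z b‖ < N + 1 := by
    rw [heq ⟨htb, le_rfl⟩]
    linarith [hxN b ⟨htb, le_rfl⟩]
  have hev : ∀ᶠ t in 𝓝[Icc t₀ (b + 1)] b, ‖z t‖ < N + 1 :=
    (hz.continuousOn b ⟨htb, by linarith⟩).norm.eventually_lt_const hzb
  obtain ⟨δ, hδ, h⟩ := Metric.eventually_nhds_iff.1 (eventually_nhdsWithin_iff.1 hev)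
  refine ⟨b + min (δ / 2) 1, by simp [hδ], z, ?_⟩
  have hc : b + min (δ / 2) 1 ≤ b + 1 := by simp
  refine (isClampedSolOn_iff hτ fun t ht => ?_).1 (hz.mono hc)
  rcases le_or_gt t b with htb' | htb'
  · rw [heq ⟨ht.1, htb'⟩]
    linarith [hxN t ⟨ht.1, htb'⟩]
  · refine (h ?_ ⟨ht.1, ht.2.trans hc⟩).le
    rw [Real.dist_eq, abs_of_pos (by linarith)]
    linarith [ht.2, min_le_left (δ / 2) 1]

theorem IsSolOn.absolutelyContinuousOnInterval (hf : LipschitzCaratheodory τ f)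
    (hτ : ∀ i, τ i ∈ Icc 0 Δ) (ht₀ : 0 ≤ t₀) (htb : t₀ ≤ b) (hx : IsSolOn τ f t₀ ξ φ b x) :
    AbsolutelyContinuousOnInterval x t₀ b := by
  obtain ⟨B, hB, h⟩ := hf.exists_ae_norm_rhs_le hτ ht₀ φ hx.continuousOn
  rw [ae_restrict_iff' measurableSet_Icc] at h
  refine LipschitzOnWith.absolutelyContinuousOnInterval (K := ⟨B, hB⟩) ?_
  rw [uIcc_of_le htb]
  have hint : ∀ t ∈ Icc t₀ b, IntervalIntegrable (rhs τ f t₀ φ x) volume t₀ t := fun t ht =>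
    hf.intervalIntegrable_rhs hτ ht₀ ht.1 φ
      (hx.continuousOn.mono (Icc_subset_Icc_right ht.2))
  refine LipschitzOnWith.of_dist_le_mul fun s hs t ht => ?_
  rw [dist_eq_norm, hx.equation s hs, hx.equation t ht, add_sub_add_left_eq_sub,
    intervalIntegral.integral_interval_sub_left (hint s hs) (hint t ht), Real.dist_eq]
  refine intervalIntegral.norm_integral_le_of_norm_le_const_ae ?_
  filter_upwards [h] with u hu hmem
  have hsub : uIoc t s ⊆ Icc t₀ b := uIoc_subset_uIcc.trans (uIcc_subset_Icc ht hs)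
  exact hu (hsub hmem)

theorem IsForwardInterval.left_le {J : Set ℝ} (hJ : IsForwardInterval t₀ J) {t : ℝ} (ht : t ∈ J) :
    t₀ ≤ t := by
  obtain ⟨b, -, rfl | rfl⟩ := hJ <;> exact ht.1

theorem IsForwardInterval.mem_of_le {J : Set ℝ} (hJ : IsForwardInterval t₀ J) {s t : ℝ}
    (hs : t₀ ≤ s) (hst : s ≤ t) (ht : t ∈ J) : s ∈ J := by
  obtain ⟨b, -, rfl | rfl⟩ := hJ
  · exact ⟨hs, (EReal.coe_le_coe_iff.2 hst).trans_lt ht.2⟩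
  · exact ⟨hs, (EReal.coe_le_coe_iff.2 hst).trans ht.2⟩

/-- Absolute continuity and integrability come for free: along a continuous function the right-hand
side is measurable and essentially bounded, so a continuous solution of the integral equation is
Lipschitz. -/
theorem isSolution_iff (hf : LipschitzCaratheodory τ f) (hτ : ∀ i, τ i ∈ Icc 0 Δ) (ht₀ : 0 ≤ t₀)
    {J : Set ℝ} : IsSolution τ f t₀ ξ φ J x ↔
      IsForwardInterval t₀ J ∧ ∀ b ∈ J, IsSolOn τ f t₀ ξ φ b x := by
  constructor
  · refine fun h => ⟨h.interval, fun b hb => ⟨?_, fun t ht => ?_⟩⟩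
    · rw [← uIcc_of_le (h.interval.left_le hb)]
      exact (h.locallyAC b hb).continuousOn
    · exact h.equation t (h.interval.mem_of_le ht.1 ht.2 hb)
  · rintro ⟨hJ, h⟩
    refine ⟨hJ, fun t ht => (h t ht).absolutelyContinuousOnInterval hf hτ ht₀ (hJ.left_le ht),
      fun t ht => hf.intervalIntegrable_rhs hτ ht₀ (hJ.left_le ht) φ (h t ht).continuousOn,
      fun t ht => (h t ht).equation t ⟨hJ.left_le ht, le_rfl⟩⟩

/-- Well-posedness: there is a unique maximal solution, and its domain is right-open. -/
theorem LipschitzCaratheodory.exists_unique_maximal (hf : LipschitzCaratheodory τ f)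
    (hτ : ∀ i, τ i ∈ Icc 0 Δ) (ht₀ : 0 ≤ t₀) (ξ : Fin n → ℝ) (φ : LInf n Δ) :
    ∃ (Tx : EReal) (x : ℝ → Fin n → ℝ), IsMaximalSolution τ f t₀ ξ φ (halfOpen t₀ Tx) x ∧
      ∀ (J : Set ℝ) (y : ℝ → Fin n → ℝ), IsMaximalSolution τ f t₀ ξ φ J y →
        J = halfOpen t₀ Tx ∧ EqOn y x J := by
  let S : Set EReal := {T | ∃ b : ℝ, T = b ∧ t₀ ≤ b ∧ ∃ x, IsSolOn τ f t₀ ξ φ b x}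
  set Tx := sSup S
  have hlt : ∀ (b : ℝ) (x : ℝ → Fin n → ℝ), t₀ ≤ b → IsSolOn τ f t₀ ξ φ b x →
      (b : EReal) < Tx := by
    intro b x hb hx
    obtain ⟨c, hc, z, hz⟩ := hx.exists_extension hf hτ ht₀ hb
    exact (EReal.coe_lt_coe_iff.2 hc).trans_le (le_sSup ⟨c, rfl, hb.trans hc.le, z, hz⟩)
  have hex : ∀ b : ℝ, b ∈ halfOpen t₀ Tx → ∃ x, IsSolOn τ f t₀ ξ φ b x := by
    rintro b ⟨-, hb⟩
    obtain ⟨-, ⟨c, rfl, -, x, hx⟩, hbc⟩ := lt_sSup_iff.1 hb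
    exact ⟨x, hx.mono (EReal.coe_lt_coe_iff.1 hbc).le⟩
  -- The constant `ξ` solves on the degenerate interval `[t₀, t₀]`, and the extension lemma starts
  -- from there.
  have hT₀ : (t₀ : EReal) < Tx := by
    refine hlt t₀ (fun _ => ξ) le_rfl ⟨continuousOn_const, fun t ht => ?_⟩
    rw [le_antisymm ht.2 ht.1]
    simp
  have hI : IsForwardInterval t₀ (halfOpen t₀ Tx) := ⟨Tx, hT₀, Or.inl rfl⟩
  choose! X hX using hex
  -- The local solutions agree on common intervals, so their diagonal glues them.
  set x : ℝ → Fin n → ℝ := fun t => X t t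
  have hxX : ∀ b ∈ halfOpen t₀ Tx, EqOn (X b) x (Icc t₀ b) := by
    intro b hb t ht
    have htm := hI.mem_of_le ht.1 ht.2 hb
    exact ((hX b hb).mono ht.2).eqOn hf hτ ht₀ (hX t htm) ⟨ht.1, le_rfl⟩
  have hxsol : ∀ b ∈ halfOpen t₀ Tx, IsSolOn τ f t₀ ξ φ b x := fun b hb =>
    (hX b hb).congr hτ (hxX b hb)
  have hsub : ∀ (J : Set ℝ) (y : ℝ → Fin n → ℝ), IsSolution τ f t₀ ξ φ J y →
      J ⊆ halfOpen t₀ Tx := by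
    intro J y hy b hb
    rw [isSolution_iff hf hτ ht₀] at hy
    exact ⟨hy.1.left_le hb, hlt b y (hy.1.left_le hb) (hy.2 b hb)⟩
  have hsol : IsSolution τ f t₀ ξ φ (halfOpen t₀ Tx) x :=
    (isSolution_iff hf hτ ht₀).2 ⟨hI, hxsol⟩
  refine ⟨Tx, x, ⟨hsol, fun J y hy hJ _ => (hsub J y hy).antisymm hJ⟩, fun J y hy => ?_⟩
  have hyx : EqOn y x J := by
    intro t ht
    have hy' := (isSolution_iff hf hτ ht₀).1 hy.1
    exact (hy'.2 t ht).eqOn hf hτ ht₀ (hxsol t (hsub J y hy.1 ht)) ⟨hy'.1.left_le ht, le_rfl⟩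
  exact ⟨(hy.2 _ x hsol (hsub J y hy.1) hyx).symm, hyx⟩

end

/-! ### Weak-* sequential compactness of balls in `L^∞` -/

section

variable {n : ℕ} {Δ : ℝ}

theorem norm_dotProduct_le (v w : Fin n → ℝ) : ‖v ⬝ᵥ w‖ ≤ n * (‖v‖ * ‖w‖) := by
  rw [dotProduct]
  refine (norm_sum_le _ _).trans ?_
  have h : ∀ i ∈ Finset.univ, ‖v i * w i‖ ≤ ‖v‖ * ‖w‖ := fun i _ => by
    rw [norm_mul]
    exact mul_le_mul (norm_le_pi_norm v i) (norm_le_pi_norm w i) (norm_nonneg _) (norm_nonneg _)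
  simpa using Finset.sum_le_sum h

theorem norm_dotProduct_le_of_norm_le {v w : Fin n → ℝ} {R : ℝ} (hw : ‖w‖ ≤ R) :
    ‖v ⬝ᵥ w‖ ≤ n * R * ‖v‖ := by
  refine (norm_dotProduct_le v w).trans ?_
  rw [mul_assoc, mul_comm R]
  gcongr

theorem aestronglyMeasurable_dotProduct {μ : Measure ℝ} {g h : ℝ → Fin n → ℝ}
    (hg : AEStronglyMeasurable g μ) (hh : AEStronglyMeasurable h μ) :
    AEStronglyMeasurable (fun s => g s ⬝ᵥ h s) μ :=
  (continuous_fst.dotProduct continuous_snd).comp_aestronglyMeasurable (hg.prodMk hh)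

theorem integrable_dotProduct_of_bound {μ : Measure ℝ} {g h : ℝ → Fin n → ℝ} {R : ℝ}
    (hg : Integrable g μ) (hh : AEStronglyMeasurable h μ) (hR : ∀ᵐ s ∂μ, ‖h s‖ ≤ R) :
    Integrable (fun s => g s ⬝ᵥ h s) μ := by
  refine (hg.norm.const_mul (n * R)).mono'
    (aestronglyMeasurable_dotProduct hg.aestronglyMeasurable hh) ?_
  filter_upwards [hR] with s hs using norm_dotProduct_le_of_norm_le hs

theorem norm_integral_dotProduct_le {μ : Measure ℝ} {g h : ℝ → Fin n → ℝ} {R : ℝ}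
    (hg : Integrable g μ) (hR : ∀ᵐ s ∂μ, ‖h s‖ ≤ R) :
    ‖∫ s, g s ⬝ᵥ h s ∂μ‖ ≤ n * R * ∫ s, ‖g s‖ ∂μ := by
  rw [← integral_const_mul]
  refine norm_integral_le_of_norm_le (hg.norm.const_mul (n * R)) ?_
  filter_upwards [hR] with s hs using norm_dotProduct_le_of_norm_le hs

/-- On a finite measure space a sequence bounded in `L^∞` is bounded in `L²`. Sequential
Banach–Alaoglu for the dual of the separable space `L²` and Riesz representation give the limit.
`EuclideanSpace` replaces the max norm on `ℝⁿ` to obtain an inner product. -/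
theorem exists_subseq_tendsto_integral_of_memLp_two (φ : ℕ → LInf n Δ) {R : ℝ}
    (hφ : ∀ k, ‖φ k‖ ≤ R) :
    ∃ (σ : ℕ → ℕ) (h : ℝ → Fin n → ℝ), StrictMono σ ∧ MemLp h 2 (histMeasure Δ) ∧
      ∀ g : ℝ → Fin n → ℝ, MemLp g 2 (histMeasure Δ) →
        Tendsto (fun k => ∫ s, g s ⬝ᵥ φ (σ k) s ∂(histMeasure Δ)) atTop
          (𝓝 (∫ s, g s ⬝ᵥ h s ∂(histMeasure Δ))) := by
  let A : (Fin n → ℝ) →L[ℝ] EuclideanSpace ℝ (Fin n) :=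
    (EuclideanSpace.equiv (Fin n) ℝ).symm.toContinuousLinearMap
  let A' : EuclideanSpace ℝ (Fin n) →L[ℝ] (Fin n → ℝ) :=
    (EuclideanSpace.equiv (Fin n) ℝ).toContinuousLinearMap
  have hφ2 : ∀ k, MemLp (fun s => A (φ k s)) 2 (histMeasure Δ) := fun k =>
    A.comp_memLp' ((Lp.memLp (φ k)).mono_exponent le_top)
  let u : ℕ → Lp (EuclideanSpace ℝ (Fin n)) 2 (histMeasure Δ) := fun k => (hφ2 k).toLp _
  obtain ⟨C, hC⟩ : ∃ C : ℝ, ∀ k, ‖u k‖ ≤ C := by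
    refine ⟨_, fun k => Lp.norm_le_of_ae_bound (C := ‖A‖ * R)
      (mul_nonneg (norm_nonneg _) ((norm_nonneg _).trans (hφ 0))) ?_⟩
    filter_upwards [(hφ2 k).coeFn_toLp, LInf.ae_norm_le (φ k)] with s hs hs'
    rw [hs]
    exact (A.le_opNorm _).trans (by gcongr; exact hs'.trans (hφ k))
  let E := Lp (EuclideanSpace ℝ (Fin n)) 2 (histMeasure Δ)
  have hball : ∀ k, StrongDual.toWeakDual (InnerProductSpace.toDual ℝ E (u k)) ∈
      WeakDual.toStrongDual ⁻¹' Metric.closedBall (0 : StrongDual ℝ E) C := by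
    intro k
    rw [mem_preimage, mem_closedBall_zero_iff]
    refine le_trans (le_of_eq ?_) (hC k)
    exact (InnerProductSpace.toDual ℝ E).norm_map (u k)
  have : Fact ((2 : ℝ≥0∞) ≠ ∞) := ⟨ENNReal.ofNat_ne_top⟩
  have : TopologicalSpace.SeparableSpace E := inferInstance
  obtain ⟨Λ, -, σ, hσ, hlim⟩ := WeakDual.isSeqCompact_closedBall ℝ E (0 : StrongDual ℝ E) C hball
  let w : E := (InnerProductSpace.toDual ℝ E).symm (WeakDual.toStrongDual Λ)
  refine ⟨σ, fun s => A' (w s), hσ, A'.comp_memLp' (Lp.memLp w), fun g hg => ?_⟩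
  have hg2 : MemLp (fun s => A (g s)) 2 (histMeasure Δ) := A.comp_memLp' hg
  have h1 : Tendsto (fun k => inner ℝ (u (σ k)) (hg2.toLp _)) atTop
      (𝓝 (inner ℝ w (hg2.toLp _))) := by
    have h2 := (WeakDual.eval_continuous (𝕜 := ℝ) (E := E) (hg2.toLp _)).tendsto Λ |>.comp hlim
    convert! h2 using 2
    exact InnerProductSpace.toDual_symm_apply
  have hinner : ∀ (v : Fin n → ℝ) (w : EuclideanSpace ℝ (Fin n)),
      inner ℝ w (A v) = v ⬝ᵥ A' w := by
    intro v w
    rw [PiLp.inner_apply, dotProduct]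
    rfl
  convert! h1 using 2
  · rw [L2.inner_def]
    refine integral_congr_ae ?_
    filter_upwards [hg2.coeFn_toLp, (hφ2 (σ ‹ℕ›)).coeFn_toLp] with s hs hs'
    rw [hs, hs', hinner]
    rfl
  · rw [L2.inner_def]
    refine integral_congr_ae ?_
    filter_upwards [hg2.coeFn_toLp] with s hs
    rw [hs, hinner]

/-- Testing with `±eᵢ` on a measurable set `A` gives `∫_A ±hᵢ ≤ R |A|` in the limit; for the max
norm these coordinate bounds suffice. -/
theorem ae_norm_le_of_tendsto_integral {φ : ℕ → LInf n Δ} {R : ℝ} (hφ : ∀ k, ‖φ k‖ ≤ R)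
    {h : ℝ → Fin n → ℝ} (hh : MemLp h 2 (histMeasure Δ))
    (hlim : ∀ g : ℝ → Fin n → ℝ, MemLp g 2 (histMeasure Δ) →
        Tendsto (fun k => ∫ s, g s ⬝ᵥ φ k s ∂(histMeasure Δ)) atTop
          (𝓝 (∫ s, g s ⬝ᵥ h s ∂(histMeasure Δ)))) :
    ∀ᵐ s ∂(histMeasure Δ), ‖h s‖ ≤ R := by
  have hR : 0 ≤ R := (norm_nonneg _).trans (hφ 0)
  have hhi : Integrable h (histMeasure Δ) := hh.integrable (by norm_num)
  have key : ∀ (i : Fin n) (c : ℝ), |c| = 1 → ∀ᵐ s ∂(histMeasure Δ), c * h s i ≤ R := by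
    intro i c hc
    refine ae_le_of_forall_setIntegral_le (f := fun s => c * h s i) (g := fun _ => R)
      ((hhi.eval i).const_mul c) (integrable_const _) fun A hA _ => ?_
    have hdot : ∀ (w : ℝ → Fin n → ℝ),
        ∫ s, A.indicator (fun _ => Pi.single i c) s ⬝ᵥ w s ∂(histMeasure Δ) =
          ∫ s in A, c * w s i ∂(histMeasure Δ) := by
      intro w
      rw [← integral_indicator hA]
      congr 1
      funext s
      by_cases hs : s ∈ A <;> simp [hs]
    have hg : MemLp (A.indicator fun _ => (Pi.single i c : Fin n → ℝ)) 2 (histMeasure Δ) :=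
      (memLp_const _).indicator hA
    have hl := hlim _ hg
    simp only [hdot] at hl
    refine le_of_tendsto' hl fun k => ?_
    refine integral_mono_ae ?_ (integrable_const _) ?_
    · exact ((((Lp.memLp (φ k)).integrable le_top).eval i).const_mul c).restrict
    · filter_upwards [ae_restrict_of_ae (LInf.ae_norm_le (φ k))] with s hs
      calc c * φ k s i ≤ |c * φ k s i| := le_abs_self _
        _ = ‖φ k s i‖ := by rw [abs_mul, hc, one_mul, Real.norm_eq_abs]
        _ ≤ R := (norm_le_pi_norm _ i).trans (hs.trans (hφ k))
  have h1 := ae_all_iff.2 fun i => key i 1 (by simp)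
  have h2 := ae_all_iff.2 fun i => key i (-1) (by simp)
  filter_upwards [h1, h2] with s hs hs'
  refine (pi_norm_le_iff_of_nonneg hR).2 fun i => ?_
  rw [Real.norm_eq_abs, abs_le]
  constructor <;> linarith [hs i, hs' i]

/-- Simple functions lie in `L²` and are dense in `L¹`, and the functionals are uniformly bounded on
`L¹`. -/
theorem weakStarTendsto_of_tendsto_of_memLp_two {φ : ℕ → LInf n Δ} {φ₀ : LInf n Δ} {R : ℝ}
    (hφ : ∀ k, ‖φ k‖ ≤ R) (hφ₀ : ‖φ₀‖ ≤ R)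
    (hlim : ∀ g : ℝ → Fin n → ℝ, MemLp g 2 (histMeasure Δ) →
        Tendsto (fun k => ∫ s, g s ⬝ᵥ φ k s ∂(histMeasure Δ)) atTop
          (𝓝 (∫ s, g s ⬝ᵥ φ₀ s ∂(histMeasure Δ)))) :
    WeakStarTendsto φ φ₀ := by
  intro g hg
  have hR : 0 ≤ R := (norm_nonneg _).trans (hφ 0)
  rw [Metric.tendsto_atTop]
  intro ε hε
  set η : ℝ := ε / (4 * (n * R + 1)) with hη
  have hη₀ : 0 < η := by positivity
  obtain ⟨p, hp, hpi⟩ := (memLp_one_iff_integrable.2 hg).exists_simpleFunc_eLpNorm_sub_lt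
    ENNReal.one_ne_top (ε := ENNReal.ofReal η) (by simpa using hη₀)
  have hp1 : Integrable p (histMeasure Δ) := memLp_one_iff_integrable.1 hpi
  have hp2 : MemLp p 2 (histMeasure Δ) := p.memLp_of_isFiniteMeasure 2 _
  have hgp : ∫ s, ‖(g - ⇑p) s‖ ∂(histMeasure Δ) < η := by
    have hgi : Integrable (g - ⇑p) (histMeasure Δ) := hg.sub hp1
    rw [integral_norm_eq_lintegral_enorm hgi.aestronglyMeasurable, ← eLpNorm_one_eq_lintegral_enorm]
    exact (ENNReal.lt_ofReal_iff_toReal_lt hp.ne_top).1 hp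
  have hdiff : ∀ ψ : LInf n Δ, ‖ψ‖ ≤ R →
      ‖(∫ s, g s ⬝ᵥ ψ s ∂(histMeasure Δ)) - ∫ s, p s ⬝ᵥ ψ s ∂(histMeasure Δ)‖ < ε / 4 := by
    intro ψ hψ
    have hb : ∀ᵐ s ∂(histMeasure Δ), ‖ψ s‖ ≤ R := (LInf.ae_norm_le ψ).mono fun s hs => hs.trans hψ
    have hm := Lp.aestronglyMeasurable ψ
    rw [← integral_sub (integrable_dotProduct_of_bound hg hm hb)
      (integrable_dotProduct_of_bound hp1 hm hb)]
    have h1 := norm_integral_dotProduct_le (hg.sub hp1) hb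
    simp only [Pi.sub_apply, sub_dotProduct] at h1 hgp
    refine h1.trans_lt ?_
    have h2 : n * R * ∫ s, ‖g s - p s‖ ∂(histMeasure Δ) ≤ n * R * η := by gcongr
    have h3 : n * R * η < (n * R + 1) * η := by gcongr; linarith
    refine (h2.trans_lt h3).trans_le (le_of_eq ?_)
    rw [hη]
    field_simp
  obtain ⟨K, hK⟩ := Metric.tendsto_atTop.1 (hlim p hp2) (ε / 4) (by positivity)
  refine ⟨K, fun k hk => ?_⟩
  have h1 := hdiff _ (hφ k)
  have h2 := hdiff _ hφ₀
  have h3 := hK k hk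
  rw [Real.dist_eq, abs_lt] at h3 ⊢
  rw [Real.norm_eq_abs, abs_lt] at h1 h2
  constructor <;> linarith [h1.1, h1.2, h2.1, h2.2, h3.1, h3.2]

/-- Balls of `L^∞` are weak-* sequentially compact. -/
theorem exists_subseq_weakStarTendsto (φ : ℕ → LInf n Δ) {R : ℝ} (hφ : ∀ k, ‖φ k‖ ≤ R) :
    ∃ (σ : ℕ → ℕ) (φ₀ : LInf n Δ), StrictMono σ ∧ ‖φ₀‖ ≤ R ∧
      WeakStarTendsto (fun k => φ (σ k)) φ₀ := by
  obtain ⟨σ, h, hσ, hh, hlim⟩ := exists_subseq_tendsto_integral_of_memLp_two φ hφ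
  have hb := ae_norm_le_of_tendsto_integral (fun k => hφ (σ k)) hh hlim
  have hmem : MemLp h ∞ (histMeasure Δ) := memLp_top_of_bound hh.aestronglyMeasurable R hb
  have hR : ‖hmem.toLp h‖ ≤ R := by
    refine LInf.norm_le_of_ae ((norm_nonneg _).trans (hφ 0)) ?_
    filter_upwards [hmem.coeFn_toLp, hb] with s hs hs'
    rwa [hs]
  refine ⟨σ, hmem.toLp h, hσ, hR, ?_⟩
  refine weakStarTendsto_of_tendsto_of_memLp_two (fun k => hφ (σ k)) hR fun g hg => ?_
  convert! hlim g hg using 2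
  refine integral_congr_ae ?_
  filter_upwards [hmem.coeFn_toLp] with s hs
  rw [hs]

end

/-! ### Weak-* continuity in the initial history -/

section

variable {n ℓ : ℕ} {Δ : ℝ} {τ : Fin (ℓ + 1) → ℝ} {f : RHS n ℓ Δ} {t₀ T : ℝ}

theorem WeakStarTendsto.history {φ : ℕ → LInf n Δ} {φ₀ : LInf n Δ} (h : WeakStarTendsto φ φ₀)
    {x : ℝ → Fin n → ℝ} (hx : ContinuousOn x (Icc t₀ T)) {t : ℝ} (ht : t ∈ Icc t₀ T) :
    WeakStarTendsto (fun k => history Δ (concat t₀ (φ k) x) t)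
      (history Δ (concat t₀ φ₀ x) t) := by
  intro g hg
  -- The part of the history before `t₀` is a translate of `φ`; moving the translation to the test
  -- function gives `g'`. The remaining part involves only `x` and is constant in `k`.
  let g' : ℝ → Fin n → ℝ :=
    (Iio 0).indicator fun u => (Icc (-Δ) 0).indicator g (u - (t - t₀))
  have hg' : Integrable g' (histMeasure Δ) := by
    have h1 : Integrable ((Icc (-Δ) 0).indicator g) volume :=
      (integrable_indicator_iff measurableSet_Icc).2 hg
    exact ((h1.comp_sub_right (t - t₀)).indicator measurableSet_Iio).restrict
  have hsplit : ∀ ψ : LInf n Δ,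
      ∫ s, g s ⬝ᵥ DelaySystem.history Δ (concat t₀ ψ x) t s ∂(histMeasure Δ) =
        ∫ s, g' s ⬝ᵥ ψ s ∂(histMeasure Δ) +
          ∫ s in (Iio (t₀ - t))ᶜ, g s ⬝ᵥ x (t + s) ∂(histMeasure Δ) := by
    intro ψ
    have hae := history_ae_eq (Lp.memLp ψ) hx ht
    have hint : Integrable (fun s => g s ⬝ᵥ concat t₀ ψ x (t + s)) (histMeasure Δ) := by
      refine (integrable_congr ?_).1 (integrable_dotProduct_of_bound hg
        (Lp.aestronglyMeasurable _) (LInf.ae_norm_le (DelaySystem.history Δ (concat t₀ ψ x) t)))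
      filter_upwards [hae] with s hs
      rw [hs]
    rw [integral_congr_ae (g := fun s => g s ⬝ᵥ concat t₀ ψ x (t + s))
      (by filter_upwards [hae] with s hs; rw [hs]),
      ← integral_add_compl (measurableSet_Iio (a := t₀ - t)) hint]
    congr 1
    · rw [← integral_indicator measurableSet_Iio, ← integral_indicator measurableSet_Icc,
        ← integral_indicator measurableSet_Icc, ← integral_add_right_eq_self
          ((Icc (-Δ) 0).indicator fun s => g' s ⬝ᵥ ψ s) (t - t₀)]
      congr 1
      funext s
      by_cases hlt : t + s < t₀
      · have hs1 : s ∈ Iio (t₀ - t) := by simp only [mem_Iio]; linarith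
        have hs2 : s + (t - t₀) ∈ Iio (0 : ℝ) := by simp only [mem_Iio]; linarith
        by_cases hs : s ∈ Icc (-Δ) 0
        · have hs3 : s + (t - t₀) ∈ Icc (-Δ) 0 := ⟨by linarith [hs.1, ht.1], hs2.le⟩
          rw [indicator_of_mem hs, indicator_of_mem hs1, indicator_of_mem hs3, concat_of_lt hlt]
          simp only [g', indicator_of_mem hs2, add_sub_cancel_right, indicator_of_mem hs]
          congr 2
          ring
        · rw [indicator_of_notMem hs, indicator_apply]
          simp only [g', indicator_of_mem hs2, add_sub_cancel_right, indicator_of_notMem hs,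
            zero_dotProduct, ite_self]
      · have hs1 : s ∉ Iio (t₀ - t) := by simp only [mem_Iio]; linarith
        have hs2 : s + (t - t₀) ∉ Iio (0 : ℝ) := by simp only [mem_Iio]; linarith
        rw [indicator_apply, indicator_of_notMem hs1, ite_self, indicator_apply]
        simp only [g', indicator_of_notMem hs2, zero_dotProduct, ite_self]
    · refine setIntegral_congr_fun measurableSet_Iio.compl fun s hs => ?_
      simp only [mem_compl_iff, mem_Iio, not_lt] at hs
      rw [concat_of_le (by linarith)]
  simp only [hsplit]
  exact (h g' hg').add_const _

/-- The right-hand side does not depend on the initial history after time `t₀ + Δ`. -/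
theorem rhs_eq_of_le (hτ : ∀ i, τ i ∈ Icc 0 Δ) {φ ψ x : ℝ → Fin n → ℝ} {s : ℝ}
    (hs : t₀ + Δ ≤ s) : rhs τ f t₀ φ x s = rhs τ f t₀ ψ x s := by
  have h1 : delayed τ (concat t₀ φ x) s = delayed τ (concat t₀ ψ x) s := by
    funext i
    have : t₀ ≤ s - τ i := by linarith [(hτ i).2]
    simp only [delayed, concat_of_le this]
  have h2 : history Δ (concat t₀ φ x) s = history Δ (concat t₀ ψ x) s :=
    history_congr fun r hr => by
      have : t₀ ≤ s + r := by linarith [hr.1]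
      rw [concat_of_le this, concat_of_le this]
  rw [rhs, rhs, h1, h2]

variable {φ : ℕ → LInf n Δ} {φ₀ : LInf n Δ} {x : ℝ → Fin n → ℝ} {R : ℝ}

/-- Dominated convergence, with the Lipschitz bound as majorant. The delayed values vary with `k`,
which is why `weakStar_continuous` must be uniform in `ξ`. -/
theorem WeakStarRegular.tendsto_integral_norm_sub (hf : WeakStarRegular τ f)
    (hτ : ∀ i, τ i ∈ Icc 0 Δ) (hΔ : 0 < Δ) (ht₀ : 0 ≤ t₀) (hR : 0 < R) (hφ : ∀ k, ‖φ k‖ ≤ R)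
    (hφ₀ : ‖φ₀‖ ≤ R) (hlim : WeakStarTendsto φ φ₀) (hx : ContinuousOn x (Icc t₀ (t₀ + Δ)))
    (hxR : ∀ t ∈ Icc t₀ (t₀ + Δ), ‖x t‖ ≤ R)
    (hmeas : ∀ᶠ k in atTop, AEStronglyMeasurable (fun s => rhs τ f t₀ (φ k) x s -
      f s (delayed τ (concat t₀ (φ k) x) s) (history Δ (concat t₀ φ₀ x) s))
      (volume.restrict (Icc t₀ (t₀ + Δ)))) :
    (∀ᶠ k in atTop, IntegrableOn (fun s => rhs τ f t₀ (φ k) x s -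
      f s (delayed τ (concat t₀ (φ k) x) s) (history Δ (concat t₀ φ₀ x) s))
      (Icc t₀ (t₀ + Δ))) ∧
    Tendsto (fun k => ∫ s in Icc t₀ (t₀ + Δ), ‖rhs τ f t₀ (φ k) x s -
      f s (delayed τ (concat t₀ (φ k) x) s) (history Δ (concat t₀ φ₀ x) s)‖) atTop (𝓝 0) := by
  have hT : 0 < t₀ + Δ := by linarith
  obtain ⟨L, hL, Z, hZ, hlip⟩ := hf.lipschitz R hR _ hT
  obtain ⟨Z', hZ', hws⟩ := hf.weakStar_continuous _ hT R hR
  have hdel : ∀ᵐ s ∂volume.restrict (Icc t₀ (t₀ + Δ)), ∀ k,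
      ‖delayed τ (concat t₀ (φ k) x) s‖ ≤ R :=
    ae_all_iff.2 fun k => ae_norm_delayed_le hτ (hφ k) hxR
  have hbound : ∀ k, ∀ᵐ s ∂volume.restrict (Icc t₀ (t₀ + Δ)), ‖rhs τ f t₀ (φ k) x s -
      f s (delayed τ (concat t₀ (φ k) x) s) (history Δ (concat t₀ φ₀ x) s)‖ ≤ L * (R + R) := by
    intro k
    filter_upwards [hdel, ae_restrict_of_ae (measure_eq_zero_iff_ae_notMem.1 hZ),
      ae_restrict_mem measurableSet_Icc] with s hs hsZ hmem
    have h1 := norm_history_le (hφ k) hx hxR hmem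
    have h2 := norm_history_le hφ₀ hx hxR hmem
    refine (hlip s ⟨⟨ht₀.trans hmem.1, hmem.2⟩, hsZ⟩ _ _ _ _ (hs k) (hs k) h1 h2).trans ?_
    gcongr
    refine max_le ?_ ((norm_sub_le _ _).trans (add_le_add h1 h2))
    rw [sub_self, norm_zero]
    linarith
  refine ⟨hmeas.mono fun k hk => Integrable.of_bound hk _ (hbound k), ?_⟩
  rw [show (0 : ℝ) = ∫ s in Icc t₀ (t₀ + Δ), (0 : ℝ) by simp]
  refine tendsto_integral_filter_of_dominated_convergence (fun _ => L * (R + R))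
    (hmeas.mono fun k hk => hk.norm)
    (Eventually.of_forall fun k => (hbound k).mono fun s hs => by rwa [norm_norm])
    (integrable_const _) ?_
  filter_upwards [hdel, ae_restrict_of_ae (measure_eq_zero_iff_ae_notMem.1 hZ'),
    ae_restrict_mem measurableSet_Icc] with s hs hsZ hmem
  rw [Metric.tendsto_atTop]
  intro ε hε
  obtain ⟨j, hj⟩ := hws ε hε _ _ (fun k => norm_history_le (hφ k) hx hxR hmem)
    (hlim.history hx hmem)
  refine ⟨j, fun k hk => ?_⟩
  rw [dist_zero_right, norm_norm]
  exact hj k hk s ⟨⟨ht₀.trans hmem.1, hmem.2⟩, hsZ⟩ _ (hs k)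

/-- Inserting the mixed term, with delayed values from `φ k` but distributed history from `φ₀`,
splits the difference into a part handled by `weakStar_continuous` and one handled by
`discrete_integral`. -/
theorem WeakStarRegular.norm_integral_rhs_sub_lt_of_le_delay (hf : WeakStarRegular τ f)
    (hτ : ∀ i, τ i ∈ Icc 0 Δ) (hΔ : 0 < Δ) (ht₀ : 0 ≤ t₀) (hR : 0 < R) (hφ : ∀ k, ‖φ k‖ ≤ R)
    (hφ₀ : ‖φ₀‖ ≤ R) (hlim : WeakStarTendsto φ φ₀) (hx : ContinuousOn x (Icc t₀ (t₀ + Δ)))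
    (hxR : ∀ t ∈ Icc t₀ (t₀ + Δ), ‖x t‖ ≤ R) {ε : ℝ} (hε : 0 < ε) :
    ∀ᶠ k in atTop, ∀ t ∈ Icc t₀ (t₀ + Δ),
      ‖∫ s in t₀..t, (rhs τ f t₀ (φ k) x s - rhs τ f t₀ φ₀ x s)‖ < ε := by
  have hle : t₀ ≤ t₀ + Δ := by linarith
  obtain ⟨j, hj⟩ := hf.discrete_integral t₀ ht₀ R hR.le x hx hxR φ φ₀ hφ hlim (ε / 2) (by linarith)
  have hrhs : ∀ ψ : LInf n Δ, IntervalIntegrable (rhs τ f t₀ ψ x) volume t₀ (t₀ + Δ) := fun ψ =>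
    hf.intervalIntegrable_rhs hτ ht₀ hle ψ hx
  -- The `measurable` field does not cover the mixed term; its measurability is recovered from the
  -- integrability contained in `discrete_integral`.
  have hmeas : ∀ᶠ k in atTop, AEStronglyMeasurable (fun s => rhs τ f t₀ (φ k) x s -
      f s (delayed τ (concat t₀ (φ k) x) s) (history Δ (concat t₀ φ₀ x) s))
      (volume.restrict (Icc t₀ (t₀ + Δ))) := by
    filter_upwards [eventually_ge_atTop j] with k hk
    have h1 := ((hrhs (φ k)).sub (hj _ (right_mem_Icc.2 hle) k hk).1).sub (hrhs φ₀)
    rw [intervalIntegrable_iff_integrableOn_Icc_of_le hle] at h1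
    refine h1.aestronglyMeasurable.congr (Eventually.of_forall fun s => ?_)
    simp only [rhs]
    abel
  obtain ⟨hint, hlim0⟩ := hf.tendsto_integral_norm_sub hτ hΔ ht₀ hR hφ hφ₀ hlim hx hxR hmeas
  filter_upwards [eventually_ge_atTop j, hint, hlim0.eventually_lt_const (half_pos hε)]
    with k hk hi hlt t ht
  have hi' : IntervalIntegrable (fun s => rhs τ f t₀ (φ k) x s -
      f s (delayed τ (concat t₀ (φ k) x) s) (history Δ (concat t₀ φ₀ x) s)) volume t₀ t :=
    (intervalIntegrable_iff_integrableOn_Icc_of_le ht.1).2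
      (hi.mono_set (Icc_subset_Icc_right ht.2))
  have hsplit : ∫ s in t₀..t, (rhs τ f t₀ (φ k) x s - rhs τ f t₀ φ₀ x s) = _ :=
    (intervalIntegral.integral_congr fun s _ => (sub_add_sub_cancel _ _ _).symm).trans
      (intervalIntegral.integral_add hi' (hj t ht k hk).1)
  rw [hsplit]
  have hA : ‖∫ s in t₀..t, (rhs τ f t₀ (φ k) x s -
      f s (delayed τ (concat t₀ (φ k) x) s) (history Δ (concat t₀ φ₀ x) s))‖ < ε / 2 := by
    refine lt_of_le_of_lt ?_ hlt
    refine (intervalIntegral.norm_integral_le_integral_norm ht.1).trans ?_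
    rw [intervalIntegral.integral_of_le ht.1]
    refine setIntegral_mono_set hi.norm (Eventually.of_forall fun s => norm_nonneg _) ?_
    exact (Ioc_subset_Icc_self.trans (Icc_subset_Icc_right ht.2)).eventuallyLE
  exact (norm_add_le _ _).trans_lt ((add_lt_add hA (hj t ht k hk).2).trans_eq (add_halves ε))

/-- Weak-* continuity in the initial history of the integrated right-hand side. -/
theorem WeakStarRegular.norm_integral_rhs_sub_lt (hf : WeakStarRegular τ f)
    (hτ : ∀ i, τ i ∈ Icc 0 Δ) (hΔ : 0 < Δ) (ht₀ : 0 ≤ t₀) (hR : 0 < R) (hφ : ∀ k, ‖φ k‖ ≤ R)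
    (hφ₀ : ‖φ₀‖ ≤ R) (hlim : WeakStarTendsto φ φ₀) (hT : t₀ ≤ T) (hx : ContinuousOn x (Icc t₀ T))
    (hxR : ∀ t ∈ Icc t₀ T, ‖x t‖ ≤ R) {ε : ℝ} (hε : 0 < ε) :
    ∀ᶠ k in atTop, ∀ t ∈ Icc t₀ T,
      ‖∫ s in t₀..t, (rhs τ f t₀ (φ k) x s - rhs τ f t₀ φ₀ x s)‖ < ε := by
  -- If `T < t₀ + Δ`, `x` is continued by its value at `T` to fill the delay interval. Past `t₀ + Δ`
  -- the two integrands coincide.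
  have hmap : MapsTo (fun u => min u T) (Icc t₀ (t₀ + Δ)) (Icc t₀ T) := fun u hu =>
    ⟨le_min hu.1 hT, min_le_right _ _⟩
  filter_upwards [hf.norm_integral_rhs_sub_lt_of_le_delay hτ hΔ ht₀ hR hφ hφ₀ hlim
    (x := fun u => x (min u T)) (hx.comp (by fun_prop) hmap) (fun t ht => hxR _ (hmap ht)) hε]
    with k hk
  have hshort : ∀ t ∈ Icc t₀ T, t ≤ t₀ + Δ →
      ‖∫ s in t₀..t, (rhs τ f t₀ (φ k) x s - rhs τ f t₀ φ₀ x s)‖ < ε := by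
    intro t ht htΔ
    convert! hk t ⟨ht.1, htΔ⟩ using 2
    refine intervalIntegral.integral_congr fun s hs => ?_
    rw [uIcc_of_le ht.1] at hs
    have heq : EqOn x (fun u => x (min u T)) (Icc t₀ s) := fun u hu => by
      simp only [min_eq_left (hu.2.trans (hs.2.trans ht.2))]
    simp only [rhs_congr hτ heq]
  intro t ht
  rcases le_or_gt t (t₀ + Δ) with htΔ | htΔ
  · exact hshort t ht htΔ
  have hint : ∀ b ∈ Icc t₀ T, IntervalIntegrable
      (fun s => rhs τ f t₀ (φ k) x s - rhs τ f t₀ φ₀ x s) volume t₀ b := fun b hb =>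
    have hx' := hx.mono (Icc_subset_Icc_right hb.2)
    (hf.intervalIntegrable_rhs hτ ht₀ hb.1 (φ k) hx').sub
      (hf.intervalIntegrable_rhs hτ ht₀ hb.1 φ₀ hx')
  have hΔT : t₀ + Δ ∈ Icc t₀ T := ⟨by linarith, htΔ.le.trans ht.2⟩
  have hzero : ∫ s in (t₀ + Δ)..t, (rhs τ f t₀ (φ k) x s - rhs τ f t₀ φ₀ x s) = 0 := by
    rw [intervalIntegral.integral_congr (g := fun _ => 0) fun s hs => ?_]
    · simp
    · rw [uIcc_of_le htΔ.le] at hs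
      simp only [rhs_eq_of_le hτ hs.1 (φ := φ k) (ψ := φ₀), sub_self]
  have hadd := intervalIntegral.integral_interval_sub_left (hint t ht) (hint _ hΔT)
  rw [hzero, sub_eq_zero] at hadd
  rw [hadd]
  exact hshort _ hΔT le_rfl

end

/-! ### Uniform boundedness by compactness -/

section

variable {n ℓ : ℕ} {Δ : ℝ} {τ : Fin (ℓ + 1) → ℝ} {f : RHS n ℓ Δ} {t₀ T : ℝ}

/-- If the limit data admit a solution on `[t₀, T]`, then solutions for convergent data are
eventually uniformly bounded. -/
theorem WeakStarRegular.exists_eventually_norm_le (hf : WeakStarRegular τ f)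
    (hτ : ∀ i, τ i ∈ Icc 0 Δ) (hΔ : 0 < Δ) (ht₀ : 0 ≤ t₀) (hT : t₀ < T) {R : ℝ}
    {ξ : ℕ → Fin n → ℝ} {ξ₀ : Fin n → ℝ} {φ : ℕ → LInf n Δ} {φ₀ : LInf n Δ}
    {x : ℕ → ℝ → Fin n → ℝ} {x₀ : ℝ → Fin n → ℝ} (hφ : ∀ k, ‖φ k‖ ≤ R) (hφ₀ : ‖φ₀‖ ≤ R)
    (hξlim : Tendsto ξ atTop (𝓝 ξ₀)) (hφlim : WeakStarTendsto φ φ₀)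
    (hx₀ : IsSolOn τ f t₀ ξ₀ φ₀ T x₀) (hx : ∀ k, IsSolOn τ f t₀ (ξ k) (φ k) T (x k)) :
    ∃ N, ∀ᶠ k in atTop, ∀ t ∈ Icc t₀ T, ‖x k t‖ ≤ N := by
  obtain ⟨M, hM, -, hx₀M⟩ := exists_common_bound φ₀ hx₀.continuousOn
  set N := max M R + 1
  have hMN : M + 1 ≤ N := by linarith [le_max_left M R]
  have hRN : R ≤ N := by linarith [le_max_right M R]
  have hN₀ : 0 < N := by linarith
  have hφN : ∀ k, ‖φ k‖ ≤ N := fun k => (hφ k).trans hRN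
  have hx₀N : ∀ t ∈ Icc t₀ T, ‖x₀ t‖ ≤ N := fun t ht => by linarith [hx₀M t ht]
  obtain ⟨L, hL⟩ := hf.exists_clamped_stability hτ hN₀ (ht₀.trans_lt hT)
  -- The defect `ε` is small enough that the stability bound is at most `1`, the gap between `M + 1
  -- ≤ N` and the bound `M` of `x₀`. It is shared equally by the errors in `ξ` and in the integral.
  obtain ⟨ε, hε, hεL⟩ : ∃ ε > 0, ∀ t ∈ Icc t₀ T, 2 * ε * Real.exp (2 * L * (t - t₀)) ≤ 1 := by
    have hc : ContinuousOn (fun t => Real.exp (2 * L * (t - t₀))) (Icc t₀ T) := by fun_prop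
    obtain ⟨C, hC⟩ := isCompact_Icc.exists_bound_of_continuousOn hc
    have hC₀ : 0 ≤ C := (norm_nonneg _).trans (hC t₀ ⟨le_rfl, hT.le⟩)
    refine ⟨1 / (2 * (C + 1)), by positivity, fun t ht => ?_⟩
    have h1 : Real.exp (2 * L * (t - t₀)) ≤ C + 1 := by
      linarith [(le_abs_self _).trans (hC t ht)]
    calc 2 * (1 / (2 * (C + 1))) * Real.exp (2 * L * (t - t₀))
        ≤ 2 * (1 / (2 * (C + 1))) * (C + 1) := by gcongr
      _ = 1 := by field_simp
  refine ⟨N, ?_⟩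
  filter_upwards [hf.norm_integral_rhs_sub_lt hτ hΔ ht₀ hN₀ hφN (hφ₀.trans hRN) hφlim hT.le
    hx₀.continuousOn hx₀N (half_pos hε), Metric.tendsto_nhds.1 hξlim (ε / 2) (half_pos hε)]
    with k hk hξk
  obtain ⟨z, hz⟩ := hf.exists_isClampedSolOn hτ ht₀ hT hN₀ (ξ k) (hφN k)
  have hclose := hL t₀ ht₀ (ξ k) (φ k) (hφN k) z x₀ hz hx₀.continuousOn hx₀N ε hε.le
    (fun t ht => by
      have hsub : Icc t₀ t ⊆ Icc t₀ T := Icc_subset_Icc_right ht.2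
      have hi : ∀ ψ : LInf n Δ, IntervalIntegrable (rhs τ f t₀ ψ x₀) volume t₀ t := fun ψ =>
        hf.intervalIntegrable_rhs hτ ht₀ ht.1 ψ (hx₀.continuousOn.mono hsub)
      have h1 := hk t ht
      rw [intervalIntegral.integral_sub (hi _) (hi _)] at h1
      rw [dist_eq_norm] at hξk
      rw [hx₀.equation t ht, add_sub_add_comm]
      exact (norm_add_le _ _).trans (by linarith))
  have hzN : ∀ t ∈ Icc t₀ T, ‖z t‖ ≤ N := fun t ht => by
    have h1 := norm_le_norm_sub_add (z t) (x₀ t)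
    linarith [hclose t ht, hεL t ht, hx₀M t ht]
  have hzsol := (isClampedSolOn_iff hτ hzN).1 hz
  intro t ht
  rw [(hx k).eqOn hf.toLipschitzCaratheodory hτ ht₀ hzsol ht]
  exact hzN t ht

/-- If all data in a ball admit a solution on `[t₀, T]`, these are uniformly bounded. -/
theorem WeakStarRegular.exists_uniform_bound (hf : WeakStarRegular τ f)
    (hτ : ∀ i, τ i ∈ Icc 0 Δ) (hΔ : 0 < Δ) (ht₀ : 0 ≤ t₀) (hT : t₀ < T) {R : ℝ}
    (hex : ∀ (ξ : Fin n → ℝ) (φ : LInf n Δ), ‖ξ‖ ≤ R → ‖φ‖ ≤ R → ∃ x, IsSolOn τ f t₀ ξ φ T x) :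
    ∃ B, ∀ (ξ : Fin n → ℝ) (φ : LInf n Δ) (x : ℝ → Fin n → ℝ), ‖ξ‖ ≤ R → ‖φ‖ ≤ R →
      IsSolOn τ f t₀ ξ φ T x → ∀ t ∈ Icc t₀ T, ‖x t‖ ≤ B := by
  by_contra! hcon
  choose ξ φ x hξ hφ hx t ht hgt using fun k : ℕ => hcon k
  obtain ⟨σ, φ₀, hσ, hφ₀, hφlim⟩ := exists_subseq_weakStarTendsto φ hφ
  obtain ⟨ξ₀, hξ₀, ρ, hρ, hξlim⟩ := (isCompact_closedBall (0 : Fin n → ℝ) R).tendsto_subseq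
    (x := fun k => ξ (σ k)) fun k => mem_closedBall_zero_iff.2 (hξ (σ k))
  obtain ⟨x₀, hx₀⟩ := hex ξ₀ φ₀ (mem_closedBall_zero_iff.1 hξ₀) hφ₀
  obtain ⟨N, hN⟩ := hf.exists_eventually_norm_le hτ hΔ ht₀ hT (fun k => hφ (σ (ρ k))) hφ₀
    hξlim (fun g hg => (hφlim g hg).comp hρ.tendsto_atTop) hx₀ (fun k => hx (σ (ρ k)))
  obtain ⟨K, hK⟩ := exists_nat_gt N
  obtain ⟨k, hk, hkK⟩ := (hN.and (eventually_ge_atTop K)).exists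
  -- The solution with index `m` exceeds `m` somewhere, and subsequence indices satisfy `σ (ρ k) ≥ k
  -- ≥ K > N`.
  have h1 : (K : ℝ) ≤ (σ (ρ k) : ℕ) :=
    Nat.cast_le.2 (hkK.trans ((hρ.le_apply).trans (hσ.le_apply)))
  linarith [hk _ (ht (σ (ρ k))), hgt (σ (ρ k))]

end

end DelaySystem

end

open DelaySystem in
theorem theorem1 {n ℓ : ℕ} (hℓ : 1 ≤ ℓ) (τ : Fin (ℓ + 1) → ℝ) (hτ₀ : τ 0 = 0)
    (hτ : StrictMono τ) (Δ : ℝ) (hΔ : τ (Fin.last ℓ) = Δ) (f : RHS n ℓ Δ)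
    (hf : WeakStarRegular τ f) :
    -- well-posedness: there is a unique maximal solution, and its domain is `[t₀, Tx)`
    (∀ t₀ ≥ 0, ∀ (ξ : Fin n → ℝ) (φ : LInf n Δ), ∃ (Tx : EReal) (x : ℝ → Fin n → ℝ),
      IsMaximalSolution τ f t₀ ξ φ (halfOpen t₀ Tx) x ∧
      ∀ (J : Set ℝ) (y : ℝ → Fin n → ℝ), IsMaximalSolution τ f t₀ ξ φ J y →
        J = halfOpen t₀ Tx ∧ Set.EqOn y x J) ∧
    -- uniform boundedness if the existence times are uniformly greater than `T`
    (∀ t₀ T R : ℝ, 0 ≤ t₀ → t₀ < T → 0 < R →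
      (T : EReal) < sInf {Tx : EReal | ∃ (ξ : Fin n → ℝ) (φ : LInf n Δ) (x : ℝ → Fin n → ℝ),
        ‖ξ‖ ≤ R ∧ ‖φ‖ ≤ R ∧ IsMaximalSolution τ f t₀ ξ φ (halfOpen t₀ Tx) x} →
      BddAbove {r : ℝ | ∃ (ξ : Fin n → ℝ) (φ : LInf n Δ) (Tx : EReal) (x : ℝ → Fin n → ℝ),
        ‖ξ‖ ≤ R ∧ ‖φ‖ ≤ R ∧ IsMaximalSolution τ f t₀ ξ φ (halfOpen t₀ Tx) x ∧
        ∃ t ∈ Set.Icc t₀ T, r = ‖x t‖}) := by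
  have hτ' : ∀ i, τ i ∈ Set.Icc 0 Δ := fun i =>
    ⟨hτ₀ ▸ hτ.monotone (Fin.zero_le i), hΔ ▸ hτ.monotone (Fin.le_last i)⟩
  have hΔ₀ : 0 < Δ := by
    rw [← hΔ, ← hτ₀]
    refine hτ (Fin.lt_def.2 ?_)
    rw [Fin.val_zero, Fin.val_last]
    exact hℓ
  have hf' := hf.toLipschitzCaratheodory
  refine ⟨fun t₀ ht₀ ξ φ => hf'.exists_unique_maximal hτ' ht₀ ξ φ, ?_⟩
  intro t₀ T R ht₀ hT _ hinf
  have hsol : ∀ (ξ : Fin n → ℝ) (φ : LInf n Δ) (Tx : EReal) (x : ℝ → Fin n → ℝ), ‖ξ‖ ≤ R →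
      ‖φ‖ ≤ R → IsMaximalSolution τ f t₀ ξ φ (halfOpen t₀ Tx) x → IsSolOn τ f t₀ ξ φ T x := by
    intro ξ φ Tx x hξ hφ hx
    exact ((isSolution_iff hf' hτ' ht₀).1 hx.1).2 T
      ⟨hT.le, hinf.trans_le (sInf_le ⟨ξ, φ, x, hξ, hφ, hx⟩)⟩
  obtain ⟨B, hB⟩ := hf.exists_uniform_bound hτ' hΔ₀ ht₀ hT (R := R) fun ξ φ hξ hφ => by
    obtain ⟨Tx, x, hx, -⟩ := hf'.exists_unique_maximal hτ' ht₀ ξ φ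
    exact ⟨x, hsol ξ φ Tx x hξ hφ hx⟩
  refine ⟨B, ?_⟩
  rintro r ⟨ξ, φ, Tx, x, hξ, hφ, hx, t, ht, rfl⟩
  exact hB ξ φ x hξ hφ (hsol ξ φ Tx x hξ hφ hx) t ht
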